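/- Let $Q_n$ be the $n$-dimensional hypercube, that is, the graph whose vertices are the binary strings of length $n$, two of them being adjacent if and only if they differ in exactly one position. Let $n \ge 4$, let $x$ and $y$ be adjacent vertices of $Q_n$, and let $k$ be an integer with $1 \le k \le n-2$. Let $\{X, Y\}$ be the bipartition of the bipartite graph $Q_n$, and let $S \subseteq X \setminus \{x,y\}$ and $T \subseteq Y \setminus \{x,y\}$ be two sets of exactly $k$ vertices each. Then there exist $k$ pairwise vertex-disjoint paths in $Q_n - \{x,y\}$, each with one end-vertex in $S$ and the other in $T$, which together contain all vertices of $Q_n - \{x,y\}$. -/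

import Mathlib

/-- The `n`-dimensional hypercube: the vertices are the binary strings of length `n`, and two
vertices are adjacent iff their strings differ in exactly one position. -/
def hypercubeGraph (n : ℕ) : SimpleGraph (Fin n → Bool) where
  Adj u v := ∃! i, u i ≠ v i
  symm := ⟨fun _ _ ⟨i, hi, hu⟩ => ⟨i, hi.symm, fun j hj => hu j hj.symm⟩⟩
  loopless := ⟨fun _ ⟨_, hi, _⟩ => hi rfl⟩

/-- `k` pairwise vertex-disjoint paths of `G`, each going from a vertex of `S` to a vertex of `T`,
whose vertices together are exactly the elements of `C`. -/
def HasDisjointPathCover {V : Type*} (G : SimpleGraph V) (S T C : Set V) (k : ℕ) : Prop :=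
  ∃ (s t : Fin k → V) (P : ∀ i, G.Walk (s i) (t i)),
    (∀ i, s i ∈ S ∧ t i ∈ T ∧ (P i).IsPath) ∧
    (∀ i j, i ≠ j → ∀ v, v ∈ (P i).support → v ∉ (P j).support) ∧
    ∀ v, v ∈ C ↔ ∃ i, v ∈ (P i).support

/-! A cover is stored as a successor map from `C \ T` to `C \ S`: injectivity keeps paths disjoint,
equal cardinality makes the map surjective, and the increasing rank excludes cycles. Gluing and
cutting paths then become local changes of this map.

The proof is an induction on dimension. A direction `d` splits a cube into two halves matched by the
edges in direction `d`. If one half has more sources than targets, auxiliary targets `U` absorb the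
surplus there, and their mirror images act as sources in the other half (`join`). If the ends of one
half exceed its capacity by one, one target `t` is set aside, the half is covered without it, and
the path through `t` is cut after `t`; this supplies the missing source (`cut`). If a half contains
no ends, it is inserted into an edge of a path in the other half (`detour`).

This is carried out first for full subcubes (`subcubeCoverable`, up to `max 1 (m - 1)` paths) and
then for subcubes without an edge in direction `d₀` (`puncturedCoverable`, up to `m - 2` paths). In
the second induction `d ≠ d₀`, so one half is punctured and the other full. It starts at `m = 3`,
where the cube without an edge is a 6-cycle with a chord, the chord being the edge opposite to the
removed one. No Hamiltonian path joins the ends of that chord, hence the extra condition there,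
which the induction has to respect when passing from 3 to 4. For `n ≥ 4` it disappears, and the
theorem is the case of the whole cube. -/

/-- An unpaired disjoint path cover of `C` from `S` to `T`, encoded by a successor function that is
injective and strictly increases a rank. -/
def PathCover {V : Type*} [DecidableEq V] (G : SimpleGraph V) (C S T : Finset V) : Prop :=
  S ⊆ C ∧ T ⊆ C ∧ S.card = T.card ∧ ∃ (f : V → V) (r : V → ℤ),
    (∀ v ∈ C, v ∉ T → f v ∈ C ∧ f v ∉ S ∧ G.Adj v (f v) ∧ r v < r (f v)) ∧
    ∀ v ∈ C, v ∉ T → ∀ w ∈ C, w ∉ T → f v = f w → v = w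

/-! ### Operations on path covers given by successor maps. -/

namespace PathCover

variable {V : Type*} [DecidableEq V] {G : SimpleGraph V}

theorem pair {s t : V} (h : G.Adj s t) : PathCover G {s, t} {s} {t} := by
  refine ⟨by simp, by simp, by simp, fun _ => t, fun v => if v = s then 0 else 1, ?_, ?_⟩
  · intro v hv hvt
    have : v = s := by simp at hv hvt; tauto
    subst this
    have := h.ne'
    simp [h, this]
  · intro v hv hvt w hw hwt _
    simp at hv hvt hw hwt
    rw [hv.resolve_right hvt, hw.resolve_right hwt]

/-- An injection of `C \ T` into `C \ S`, sets of equal size, is onto. -/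
theorem exists_pred {C S T : Finset V} (hS : S ⊆ C) (hT : T ⊆ C) (hc : S.card = T.card)
    {f : V → V} (hf : ∀ v ∈ C, v ∉ T → f v ∈ C ∧ f v ∉ S)
    (hi : ∀ v ∈ C, v ∉ T → ∀ w ∈ C, w ∉ T → f v = f w → v = w) {w : V} (hw : w ∈ C)
    (hwS : w ∉ S) : ∃ v ∈ C, v ∉ T ∧ f v = w := by
  have := Finset.surjOn_of_injOn_of_card_le (s := C \ T) (t := C \ S) f
    (fun v hv => by
      have hv := Finset.mem_sdiff.1 hv
      exact Finset.mem_coe.2 (Finset.mem_sdiff.2 (hf v hv.1 hv.2)))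
    (fun v hv w hw h => by
      have hv := Finset.mem_sdiff.1 hv
      have hw := Finset.mem_sdiff.1 hw
      exact hi v hv.1 hv.2 w hw.1 hw.2 h)
    (by rw [Finset.card_sdiff_of_subset hS, Finset.card_sdiff_of_subset hT, hc])
  obtain ⟨v, hv, h⟩ := this (Finset.mem_coe.2 (Finset.mem_sdiff.2 ⟨hw, hwS⟩))
  have hv := Finset.mem_sdiff.1 hv
  exact ⟨v, hv.1, hv.2, h⟩

/-- All paths are reversed: predecessors replace successors and the rank changes sign. -/
theorem symm {C S T : Finset V} (h : PathCover G C S T) : PathCover G C T S := by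
  obtain ⟨hS, hT, hc, f, r, hf, hi⟩ := h
  have hp : ∀ w : V, ∃ v, w ∈ C → w ∉ S → v ∈ C ∧ v ∉ T ∧ f v = w := fun w => by
    by_cases hw : w ∈ C ∧ w ∉ S
    · obtain ⟨v, h1, h2, h3⟩ := exists_pred hS hT hc
        (fun v h1 h2 => ⟨(hf v h1 h2).1, (hf v h1 h2).2.1⟩) hi hw.1 hw.2
      exact ⟨v, fun _ _ => ⟨h1, h2, h3⟩⟩
    · exact ⟨w, fun h1 h2 => absurd ⟨h1, h2⟩ hw⟩
  choose g hg using hp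
  refine ⟨hT, hS, hc.symm, g, fun v => - r v, ?_, ?_⟩
  · intro w hw hwS
    obtain ⟨h1, h2, h3⟩ := hg w hw hwS
    obtain ⟨-, -, h4, h5⟩ := hf _ h1 h2
    rw [h3] at h4 h5
    exact ⟨h1, h2, h4.symm, by linarith⟩
  · intro v hv hvS w hw hwS h
    rw [← (hg v hv hvS).2.2, ← (hg w hw hwS).2.2, h]

theorem exists_bound {V : Type*} [Finite V] (r : V → ℤ) : ∃ N : ℤ, ∀ v, -N < r v ∧ r v < N := by
  obtain ⟨a, ha⟩ := (Set.finite_range fun v => |r v|).bddAbove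
  refine ⟨a + 1, fun v => ?_⟩
  have : |r v| ≤ a := ha ⟨v, rfl⟩
  have := abs_le.1 this
  constructor <;> linarith

/-- Paths ending in `U` are continued along the edges `u — g u` in a disjoint part. -/
theorem join [Finite V] {C₀ C₁ S₀ S₁ T₀ T₁ U : Finset V} {g : V → V}
    (hg : Function.Injective g) (hadj : ∀ u, G.Adj u (g u))
    (h₀ : PathCover G C₀ S₀ (T₀ ∪ U)) (h₁ : PathCover G C₁ (S₁ ∪ U.image g) T₁)
    (hC : Disjoint C₀ C₁) (hT : Disjoint T₀ U) (hS : Disjoint S₁ (U.image g)) :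
    PathCover G (C₀ ∪ C₁) (S₀ ∪ S₁) (T₀ ∪ T₁) := by
  obtain ⟨a1, a2, a3, f₀, r₀, a4, a5⟩ := h₀
  obtain ⟨b1, b2, b3, f₁, r₁, b4, b5⟩ := h₁
  obtain ⟨N, hN⟩ := exists_bound r₀
  obtain ⟨M, hM⟩ := exists_bound r₁
  have hT₀ : T₀ ⊆ C₀ := Finset.subset_union_left.trans a2
  have hU : U ⊆ C₀ := Finset.subset_union_right.trans a2
  have hS₁ : S₁ ⊆ C₁ := Finset.subset_union_left.trans b1
  have hU₁ : ∀ u ∈ U, g u ∈ C₁ := fun u hu =>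
    b1 (Finset.mem_union_right _ (Finset.mem_image_of_mem g hu))
  have hUS : ∀ u ∈ U, g u ∉ S₁ := fun u hu h =>
    Finset.disjoint_left.1 hS h (Finset.mem_image_of_mem g hu)
  have hd : ∀ v ∈ C₀, v ∉ C₁ := fun _ h => Finset.disjoint_left.1 hC h
  have key : ∀ v ∈ C₀ ∪ C₁, v ∉ T₀ ∪ T₁ →
      (v ∈ U) ∨ (v ∈ C₀ ∧ v ∉ U ∧ v ∉ T₀ ∪ U) ∨ (v ∈ C₁ ∧ v ∉ C₀ ∧ v ∉ U ∧ v ∉ T₁) := by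
    intro v hv hvT
    simp only [Finset.mem_union, not_or] at hv hvT ⊢
    by_cases h : v ∈ U
    · exact Or.inl h
    by_cases h' : v ∈ C₀
    · exact Or.inr (Or.inl ⟨h', h, hvT.1, h⟩)
    · exact Or.inr (Or.inr ⟨hv.resolve_left h', h', h, hvT.2⟩)
  -- The shift by `N + M` puts every rank on `C₁` above `N`, hence above all ranks on `C₀`.
  refine ⟨Finset.union_subset_union a1 hS₁, Finset.union_subset_union hT₀ b2, ?_,
    fun v => if v ∈ U then g v else if v ∈ C₀ then f₀ v else f₁ v,
    fun v => if v ∈ C₀ then r₀ v else r₁ v + N + M, ?_, ?_⟩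
  · rw [Finset.card_union_of_disjoint (Finset.disjoint_of_subset_left a1
      (Finset.disjoint_of_subset_right hS₁ hC)), Finset.card_union_of_disjoint
      (Finset.disjoint_of_subset_left hT₀ (Finset.disjoint_of_subset_right b2 hC))]
    rw [Finset.card_union_of_disjoint hT] at a3
    rw [Finset.card_union_of_disjoint hS, Finset.card_image_of_injective _ hg] at b3
    omega
  · intro v hv hvT
    rcases key v hv hvT with h | ⟨h1, h2, h3⟩ | ⟨h1, h2, h3, h4⟩
    · have h5 : g v ∉ C₀ := fun h' => hd _ h' (hU₁ v h)
      have h6 : g v ∉ S₀ := fun h' => h5 (a1 h')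
      simp only [h, if_true, hU h, h5, if_false, Finset.mem_union, hU₁ v h, h6, hUS v h,
        or_false, or_true, not_false_iff, hadj, true_and]
      linarith [(hN v).2, (hM (g v)).1]
    · obtain ⟨c1, c2, c3, c4⟩ := a4 v h1 h3
      have : f₀ v ∉ S₁ := fun h' => hd _ c1 (hS₁ h')
      simp only [h1, h2, if_true, if_false, Finset.mem_union, c1, c2, c3, c4, this, true_or,
        or_false, not_false_iff, and_self]
    · obtain ⟨c1, c2, c3, c4⟩ := b4 v h1 h4
      have c5 : f₁ v ∉ C₀ := fun h' => hd _ h' c1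
      have c6 : f₁ v ∉ S₀ := fun h' => c5 (a1 h')
      have c7 : f₁ v ∉ S₁ := fun h' => c2 (Finset.mem_union_left _ h')
      simp only [h2, h3, if_false, Finset.mem_union, c1, c3, c5, c6, c7, or_true,
        or_false, not_false_iff, true_and]
      linarith
  · intro v hv hvT w hw hwT hvw
    have im : ∀ u ∈ U, ∀ z ∈ C₁, z ∉ T₁ → g u ≠ f₁ z := fun u hu z hz hzT h =>
      (b4 z hz hzT).2.1 (h ▸ Finset.mem_union_right _ (Finset.mem_image_of_mem g hu))
    rcases key v hv hvT with h | ⟨h1, h2, h3⟩ | ⟨h1, h2, h3, h4⟩ <;>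
    rcases key w hw hwT with k | ⟨k1, k2, k3⟩ | ⟨k1, k2, k3, k4⟩
    · simp only [h, k, if_true] at hvw; exact hg hvw
    · simp only [h, k1, k2, if_true, if_false] at hvw
      exact absurd (hU₁ v h) (hd _ (hvw ▸ (a4 w k1 k3).1))
    · simp only [h, k2, k3, if_true, if_false] at hvw
      exact absurd hvw (im v h w k1 k4)
    · simp only [k, h1, h2, if_true, if_false] at hvw
      exact absurd (hU₁ w k) (hd _ (hvw ▸ (a4 v h1 h3).1))
    · simp only [h1, h2, k1, k2, if_true, if_false] at hvw
      exact a5 v h1 h3 w k1 k3 hvw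
    · simp only [h1, h2, k2, k3, if_true, if_false] at hvw
      exact absurd (b4 w k1 k4).1 (hd _ (hvw ▸ (a4 v h1 h3).1))
    · simp only [k, h2, h3, if_true, if_false] at hvw
      exact absurd hvw.symm (im w k v h1 h4)
    · simp only [k1, k2, h2, h3, if_true, if_false] at hvw
      exact absurd (b4 v h1 h4).1 (hd _ (hvw ▸ (a4 w k1 k3).1))
    · simp only [h2, h3, k2, k3, if_false] at hvw
      exact b5 v h1 h4 w k1 k4 hvw

theorem union [Finite V] {C₀ C₁ S₀ S₁ T₀ T₁ : Finset V} {g : V → V}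
    (hg : Function.Injective g) (hadj : ∀ u, G.Adj u (g u))
    (h₀ : PathCover G C₀ S₀ T₀) (h₁ : PathCover G C₁ S₁ T₁) (hC : Disjoint C₀ C₁) :
    PathCover G (C₀ ∪ C₁) (S₀ ∪ S₁) (T₀ ∪ T₁) :=
  join (U := ∅) hg hadj (by simpa using h₀) (by simpa using h₁) hC (by simp) (by simp)

/-- Cutting a path after the vertex `t`. -/
theorem cut {C S T : Finset V} (h : PathCover G C S T) {t : V} (ht : t ∈ C) (htT : t ∉ T) :
    ∃ z ∈ C, z ∉ S ∧ G.Adj t z ∧ PathCover G C (insert z S) (insert t T) := by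
  obtain ⟨h1, h2, h3, f, r, h4, h5⟩ := h
  obtain ⟨c1, c2, c3, c4⟩ := h4 t ht htT
  refine ⟨f t, c1, c2, c3, Finset.insert_subset c1 h1, Finset.insert_subset ht h2, ?_, f, r, ?_, ?_⟩
  · rw [Finset.card_insert_of_notMem c2, Finset.card_insert_of_notMem htT, h3]
  · intro v hv hvT
    simp only [Finset.mem_insert, not_or] at hvT ⊢
    obtain ⟨d1, d2, d3⟩ := h4 v hv hvT.2
    exact ⟨d1, ⟨fun h => hvT.1 (h5 v hv hvT.2 t ht htT h), d2⟩, d3⟩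
  · intro v hv hvT w hw hwT
    simp only [Finset.mem_insert, not_or] at hvT hwT
    exact h5 v hv hvT.2 w hw hwT.2

/-- Replacing some edge `a — b` of a cover by a detour through a disjoint part. -/
theorem detour [Finite V] {C₀ C₁ S T A B : Finset V} (h : PathCover G C₀ S T)
    (hC : Disjoint C₀ C₁) (hA : A ⊆ C₀) (hAT : Disjoint A T) (hBA : B.card < A.card)
    (hins : ∀ a ∈ A, ∀ b ∈ C₀, b ∉ S → b ∉ B → G.Adj a b →
      ∃ a' b', G.Adj a a' ∧ G.Adj b' b ∧ PathCover G C₁ {a'} {b'}) :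
    PathCover G (C₀ ∪ C₁) S T := by
  obtain ⟨h1, h2, h3, f, r, h4, h5⟩ := h
  have hAT' : ∀ a ∈ A, a ∉ T := fun a ha => Finset.disjoint_left.1 hAT ha
  -- The successor map is injective on `A`, so it cannot send all of `A` into the smaller set `B`.
  obtain ⟨a, haA, hab⟩ : ∃ a ∈ A, f a ∉ B := by
    by_contra! hcon
    refine absurd (Finset.card_le_card_of_injOn f hcon ?_) (not_le.2 hBA)
    intro v hv w hw hvw
    exact h5 v (hA hv) (hAT' v hv) w (hA hw) (hAT' w hw) hvw
  have haC := hA haA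
  have haT := hAT' a haA
  obtain ⟨c1, c2, c3, c4⟩ := h4 a haC haT
  obtain ⟨a', b', haa, hbb, k1, k2, -, f', r', k4, k5⟩ := hins a haA _ c1 c2 hab c3
  have ha' : a' ∈ C₁ := by simpa using k1
  have hb' : b' ∈ C₁ := by simpa using k2
  obtain ⟨N, hN⟩ := exists_bound r'
  have hd : ∀ v ∈ C₁, v ∉ C₀ := fun _ h => Finset.disjoint_right.1 hC h
  have key : ∀ v ∈ C₀ ∪ C₁, v ∉ T → v = a ∨ (v ∈ C₀ ∧ v ≠ a ∧ v ≠ b' ∧ v ∉ T) ∨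
      (v = b' ∧ b' ≠ a) ∨ (v ∈ C₁ ∧ v ∉ C₀ ∧ v ≠ a ∧ v ≠ b' ∧ v ∉ ({b'} : Finset V)) := by
    intro v hv hvT
    by_cases e : v = a
    · exact Or.inl e
    by_cases e' : v ∈ C₀
    · exact Or.inr (Or.inl ⟨e', e, fun h => hd _ hb' (h ▸ e'), hvT⟩)
    by_cases e2 : v = b'
    · exact Or.inr (Or.inr (Or.inl ⟨e2, e2 ▸ e⟩))
    · exact Or.inr (Or.inr (Or.inr
        ⟨(Finset.mem_union.1 hv).resolve_left e', e', e, e2, by simpa using e2⟩))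
  -- Scaling by `2 * N` opens a gap of at least `2 * N` between `a` and its successor; the ranks `N
  -- + r'` of the detour lie strictly between 0 and `2 * N`.
  refine ⟨h1.trans Finset.subset_union_left, h2.trans Finset.subset_union_left, h3,
    fun v => if v = a then a' else if v = b' then f a else if v ∈ C₀ then f v else f' v,
    fun v => if v ∈ C₀ then 2 * N * r v else 2 * N * r a + N + r' v, ?_, ?_⟩
  · have hNpos : 0 < N := by linarith [hN a]
    have step : ∀ u v, r u < r v → 2 * N * r u + 2 * N ≤ 2 * N * r v := fun u v huv => by
      nlinarith [Int.add_one_le_iff.2 huv]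
    intro v hv hvT
    rcases key v hv hvT with rfl | ⟨e1, e2, e3, e4⟩ | ⟨rfl, e1⟩ | ⟨e1, e2, e3, e4, e5⟩
    · have := hd _ ha'
      simp only [if_true, Finset.mem_union, ha', or_true, this, if_false, haC, haa, true_and]
      exact ⟨fun h => this (h1 h), by linarith [(hN a').1]⟩
    · obtain ⟨d1, d2, d3, d4⟩ := h4 v e1 e4
      simp only [e1, e2, e3, if_true, if_false, Finset.mem_union, d1, true_or, d2,
        not_false_iff, d3, true_and]
      linarith [step _ _ d4]
    · have := hd _ hb'
      simp only [e1, if_true, if_false, Finset.mem_union, c1, true_or, c2, not_false_iff, hbb,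
        this, true_and]
      linarith [step _ _ c4, (hN v).2]
    · obtain ⟨d1, d2, d3, d4⟩ := k4 v e1 e5
      have := hd _ d1
      simp only [e2, e3, e4, if_false, Finset.mem_union, d1, or_true, d3, this, true_and]
      exact ⟨fun h => this (h1 h), by linarith⟩
  · have hfa : ∀ v ∈ C₁, v ∉ ({b'} : Finset V) → f' v ≠ a' := fun v hv hv' h =>
      (k4 v hv hv').2.1 (by simp [h])
    intro v hv hvT w hw hwT hvw
    rcases key v hv hvT with rfl | ⟨e1, e2, e3, e4⟩ | ⟨rfl, e1⟩ | ⟨e1, e2, e3, e4, e5⟩ <;>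
    rcases key w hw hwT with rfl | ⟨g1, g2, g3, g4⟩ | ⟨rfl, g1⟩ | ⟨g1, g2, g3, g4, g5⟩
    · rfl
    · simp only [g1, g2, g3, if_true, if_false] at hvw
      exact absurd (h4 w g1 g4).1 (hvw ▸ hd _ ha')
    · simp only [g1, if_true, if_false] at hvw
      exact absurd c1 (hvw ▸ hd _ ha')
    · simp only [g2, g3, g4, if_true, if_false] at hvw
      exact absurd hvw.symm (hfa w g1 g5)
    · simp only [e1, e2, e3, if_true, if_false] at hvw
      exact absurd (h4 v e1 e4).1 (hvw ▸ hd _ ha')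
    · simp only [e1, e2, e3, g1, g2, g3, if_true, if_false] at hvw
      exact h5 v e1 e4 w g1 g4 hvw
    · simp only [e1, e2, e3, g1, if_true, if_false] at hvw
      exact absurd (h5 v e1 e4 a haC haT hvw) e2
    · simp only [e1, e2, e3, g2, g3, g4, if_true, if_false] at hvw
      exact absurd (h4 v e1 e4).1 (hvw ▸ hd _ (k4 w g1 g5).1)
    · simp only [e1, if_true, if_false] at hvw
      exact absurd c1 (hvw ▸ hd _ ha')
    · simp only [e1, g1, g2, g3, if_true, if_false] at hvw
      exact absurd (h5 w g1 g4 a haC haT hvw.symm) g2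
    · rfl
    · simp only [e1, g2, g3, g4, if_true, if_false] at hvw
      exact absurd c1 (hvw ▸ hd _ (k4 w g1 g5).1)
    · simp only [e2, e3, e4, if_true, if_false] at hvw
      exact absurd hvw (hfa v e1 e5)
    · simp only [e2, e3, e4, g1, g2, g3, if_true, if_false] at hvw
      exact absurd (h4 w g1 g4).1 (hvw ▸ hd _ (k4 v e1 e5).1)
    · simp only [g1, e2, e3, e4, if_true, if_false] at hvw
      exact absurd c1 (hvw ▸ hd _ (k4 v e1 e5).1)
    · simp only [e2, e3, e4, g2, g3, g4, if_false] at hvw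
      exact k5 v e1 e5 w g1 g5 hvw

/-- A successor function yields honest paths, whose supports are the orbits of the sources. -/
theorem hasDisjointPathCover [Finite V] {C S T : Finset V} (h : PathCover G C S T) :
    HasDisjointPathCover G (S : Set V) T C S.card := by
  obtain ⟨h1, h2, h3, f, r, h4, h5⟩ := h
  obtain ⟨N, hN⟩ := exists_bound r
  let E : V → V → Prop := fun a b => a ∈ C ∧ a ∉ T ∧ f a = b
  -- Induction on the distance of the rank from its upper bound. The bound `r v ≤ r w` on the
  -- support makes the extended walk a path.
  have hwalk : ∀ (m : ℕ) (v : V), v ∈ C → N - r v ≤ m → ∃ t ∈ T, ∃ P : G.Walk v t, P.IsPath ∧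
      (∀ w ∈ P.support, r v ≤ r w) ∧ ∀ w, w ∈ P.support ↔ Relation.ReflTransGen E v w := by
    intro m
    induction m with
    | zero => intro v _ hm; have := hN v; push_cast at hm; linarith
    | succ m ih =>
      intro v hv hm
      by_cases hvT : v ∈ T
      · refine ⟨v, hvT, SimpleGraph.Walk.nil, by simp, by simp, fun w => ?_⟩
        rw [Relation.ReflTransGen.cases_head_iff]
        simp only [SimpleGraph.Walk.support_nil, List.mem_singleton]
        constructor
        · exact fun h => Or.inl h.symm
        · rintro (h | ⟨c, ⟨-, hc, -⟩, -⟩)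
          · exact h.symm
          · exact absurd hvT hc
      · obtain ⟨c1, -, c3, c4⟩ := h4 v hv hvT
        obtain ⟨t, ht, P, hP, hr, hs⟩ := ih (f v) c1 (by push_cast at hm; linarith)
        refine ⟨t, ht, SimpleGraph.Walk.cons c3 P, ?_, ?_, fun w => ?_⟩
        · rw [SimpleGraph.Walk.cons_isPath_iff]
          exact ⟨hP, fun h => absurd (hr v h) (not_le.2 c4)⟩
        · intro w hw
          rw [SimpleGraph.Walk.support_cons, List.mem_cons] at hw
          rcases hw with rfl | hw
          · exact le_rfl
          · exact c4.le.trans (hr w hw)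
        · rw [SimpleGraph.Walk.support_cons, List.mem_cons, hs w,
            Relation.ReflTransGen.cases_head_iff (a := v)]
          constructor
          · rintro (h | h)
            · exact Or.inl h.symm
            · exact Or.inr ⟨f v, ⟨hv, hvT, rfl⟩, h⟩
          · rintro (h | ⟨c, ⟨-, -, rfl⟩, hc⟩)
            · exact Or.inl h.symm
            · exact Or.inr hc
  -- Going back from `w`, predecessors are unique and no source has one, so only one source reaches
  -- `w`.
  have huniq : ∀ s ∈ S, ∀ w, Relation.ReflTransGen E s w →
      ∀ s' ∈ S, Relation.ReflTransGen E s' w → s' = s := by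
    intro s hs w hw
    induction hw with
    | refl =>
      intro s' hs' h
      rcases Relation.ReflTransGen.cases_tail h with h | ⟨c, -, ⟨h6, h7, rfl⟩⟩
      · exact h.symm
      · exact absurd hs (h4 c h6 h7).2.1
    | tail hab hbc ih =>
      intro s' hs' h
      obtain ⟨h6, h7, rfl⟩ := hbc
      rcases Relation.ReflTransGen.cases_tail h with h | ⟨c, hc, ⟨h8, h9, h10⟩⟩
      · exact absurd hs' (h ▸ (h4 _ h6 h7).2.1)
      · obtain rfl := h5 _ h8 h9 _ h6 h7 h10
        exact ih s' hs' hc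
  have hcov : ∀ (m : ℕ) (v : V), v ∈ C → r v + N ≤ m → ∃ s ∈ S, Relation.ReflTransGen E s v := by
    intro m
    induction m with
    | zero => intro v _ hm; have := hN v; push_cast at hm; linarith
    | succ m ih =>
      intro v hv hm
      by_cases hvS : v ∈ S
      · exact ⟨v, hvS, .refl⟩
      · obtain ⟨w, h6, h7, rfl⟩ := exists_pred h1 h2 h3
          (fun v h1 h2 => ⟨(h4 v h1 h2).1, (h4 v h1 h2).2.1⟩) h5 hv hvS
        obtain ⟨s, hs, hsw⟩ := ih w h6 (by have := (h4 w h6 h7).2.2.2; push_cast at hm; linarith)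
        exact ⟨s, hs, hsw.tail ⟨h6, h7, rfl⟩⟩
  have hC : ∀ s ∈ S, ∀ w, Relation.ReflTransGen E s w → w ∈ C := by
    intro s hs w hw
    rcases Relation.ReflTransGen.cases_tail hw with h | ⟨c, -, ⟨h6, h7, rfl⟩⟩
    · exact h ▸ h1 hs
    · exact (h4 c h6 h7).1
  have hex : ∀ s : S, ∃ t ∈ T, ∃ P : G.Walk s t, P.IsPath ∧
      ∀ w, w ∈ P.support ↔ Relation.ReflTransGen E s w := fun s => by
    obtain ⟨t, ht, P, hP, -, hs⟩ :=
      hwalk (N - r s).toNat s (h1 s.2) (Int.self_le_toNat _)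
    exact ⟨t, ht, P, hP, hs⟩
  choose t ht P hP hsupp using hex
  let e := S.equivFin.symm
  refine ⟨fun i => e i, fun i => t (e i), fun i => P (e i),
    fun i => ⟨(e i).2, ht _, hP _⟩, ?_, ?_⟩
  · intro i j hij v hv hv'
    rw [hsupp] at hv hv'
    exact hij (e.injective (Subtype.ext (huniq _ (e j).2 v hv' _ (e i).2 hv)))
  · intro v
    simp only [Finset.mem_coe, hsupp]
    constructor
    · intro hv
      obtain ⟨s, hs, hsv⟩ := hcov (r v + N).toNat v hv (Int.self_le_toNat _)
      exact ⟨e.symm ⟨s, hs⟩, by simpa using hsv⟩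
    · rintro ⟨i, hi⟩
      exact hC _ (e i).2 v hi

end PathCover

/-! ### Subcubes, their halves and their covers. -/

section Subcube

variable {n : ℕ}

/-- The vertex obtained from `v` by changing position `i`. -/
def flipAt (i : Fin n) (v : Fin n → Bool) : Fin n → Bool := Function.update v i (!v i)

@[simp] theorem flipAt_same (i : Fin n) (v : Fin n → Bool) : flipAt i v i = !v i := by
  simp [flipAt]

theorem flipAt_of_ne {i j : Fin n} (h : j ≠ i) (v : Fin n → Bool) : flipAt i v j = v j := by
  simp [flipAt, h]

@[simp] theorem flipAt_flipAt (i : Fin n) (v : Fin n → Bool) : flipAt i (flipAt i v) = v := by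
  simp [flipAt]

theorem flipAt_injective (i : Fin n) : Function.Injective (flipAt i) :=
  Function.LeftInverse.injective (g := flipAt i) (flipAt_flipAt i)

theorem adj_flipAt (i : Fin n) (v : Fin n → Bool) : (hypercubeGraph n).Adj v (flipAt i v) := by
  refine ⟨i, by simp, fun j hj => ?_⟩
  by_contra h
  exact hj (flipAt_of_ne h v).symm

theorem exists_eq_flipAt {u v : Fin n → Bool} (h : (hypercubeGraph n).Adj u v) :
    ∃ i, v = flipAt i u := by
  obtain ⟨i, hi, hu⟩ := h
  refine ⟨i, funext fun j => ?_⟩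
  by_cases hj : j = i
  · subst hj
    rw [flipAt_same]
    revert hi
    cases u j <;> cases v j <;> simp
  · rw [flipAt_of_ne hj]
    by_contra hne
    exact hj (hu j (Ne.symm hne))

/-- The subcube through `v` in the directions of `D`. -/
def subcube (D : Finset (Fin n)) (v : Fin n → Bool) : Finset (Fin n → Bool) :=
  Finset.univ.filter fun w => ∀ i, i ∉ D → w i = v i

variable {D : Finset (Fin n)} {v w : Fin n → Bool} {d : Fin n}

theorem mem_subcube : w ∈ subcube D v ↔ ∀ i, i ∉ D → w i = v i := by simp [subcube]

theorem self_mem_subcube : v ∈ subcube D v := by simp [mem_subcube]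

theorem subcube_flipAt (hd : d ∈ D) (v : Fin n → Bool) : subcube D (flipAt d v) = subcube D v := by
  ext w
  simp only [mem_subcube]
  refine forall_congr' fun i => imp_congr_right fun hi => ?_
  rw [flipAt_of_ne (by rintro rfl; exact hi hd)]

theorem flipAt_mem_subcube (hd : d ∈ D) (h : w ∈ subcube D v) : flipAt d w ∈ subcube D v := by
  rw [mem_subcube] at *
  intro i hi
  rw [flipAt_of_ne (by rintro rfl; exact hi hd), h i hi]

theorem mem_subcube_erase (hd : d ∈ D) :
    w ∈ subcube (D.erase d) v ↔ w ∈ subcube D v ∧ w d = v d := by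
  simp only [mem_subcube, Finset.mem_erase, not_and_or, not_not]
  constructor
  · exact fun h => ⟨fun i hi => h i (Or.inr hi), h d (Or.inl rfl)⟩
  · rintro ⟨h1, h2⟩ i (rfl | hi)
    · exact h2
    · exact h1 i hi

theorem mem_subcube_erase_flipAt (hd : d ∈ D) :
    w ∈ subcube (D.erase d) (flipAt d v) ↔ w ∈ subcube D v ∧ w d ≠ v d := by
  rw [mem_subcube_erase hd, subcube_flipAt hd, flipAt_same]
  cases w d <;> cases v d <;> simp

theorem subcube_eq_union (hd : d ∈ D) (v : Fin n → Bool) :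
    subcube D v = subcube (D.erase d) v ∪ subcube (D.erase d) (flipAt d v) := by
  ext w
  rw [Finset.mem_union, mem_subcube_erase hd, mem_subcube_erase_flipAt hd]
  tauto

theorem disjoint_subcube_erase (hd : d ∈ D) (v : Fin n → Bool) :
    Disjoint (subcube (D.erase d) v) (subcube (D.erase d) (flipAt d v)) := by
  rw [Finset.disjoint_left]
  intro w h1 h2
  rw [mem_subcube_erase hd] at h1
  rw [mem_subcube_erase_flipAt hd] at h2
  exact h2.2 h1.2

theorem flipAt_mem_subcube_flipAt (hd : d ∈ D) (h : w ∈ subcube (D.erase d) v) :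
    flipAt d w ∈ subcube (D.erase d) (flipAt d v) := by
  rw [mem_subcube_erase hd] at h
  rw [mem_subcube_erase_flipAt hd]
  refine ⟨flipAt_mem_subcube hd h.1, ?_⟩
  rw [flipAt_same, h.2]
  simp

theorem flipAt_mem_subcube_of_flipAt (hd : d ∈ D) (h : w ∈ subcube (D.erase d) (flipAt d v)) :
    flipAt d w ∈ subcube (D.erase d) v := by
  simpa using flipAt_mem_subcube_flipAt hd h

theorem card_subcube (D : Finset (Fin n)) (v : Fin n → Bool) : (subcube D v).card = 2 ^ D.card := by
  induction D using Finset.induction_on generalizing v with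
  | empty =>
    have : subcube ∅ v = {v} := by ext w; simp [mem_subcube, funext_iff]
    simp [this]
  | insert d D hd ih =>
    have := disjoint_subcube_erase (Finset.mem_insert_self d D) v
    rw [subcube_eq_union (Finset.mem_insert_self d D), Finset.card_union_of_disjoint this,
      Finset.erase_insert hd, ih, ih, Finset.card_insert_of_notMem hd, pow_succ]
    ring

/-! ### Colour classes and covers of full subcubes. -/

variable {col : (Fin n → Bool) → Bool} (hcol : ∀ i v, col (flipAt i v) = !col v)

include hcol in
theorem card_filter_col {m : ℕ} (hD : D.card = m + 1) (v : Fin n → Bool) (c : Bool) :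
    ((subcube D v).filter fun w => col w = c).card = 2 ^ m := by
  obtain ⟨d, hd⟩ : D.Nonempty := Finset.card_pos.1 (by omega)
  have h1 := Finset.card_filter_add_card_filter_not (s := subcube D v) (fun w => col w = c)
  have h2 : ((subcube D v).filter fun w => col w = c).card =
      ((subcube D v).filter fun w => ¬ col w = c).card := by
    refine Finset.card_bij' (fun w _ => flipAt d w) (fun w _ => flipAt d w) ?_ ?_ ?_ ?_
    · intro w hw
      rw [Finset.mem_filter] at *
      exact ⟨flipAt_mem_subcube hd hw.1, by rw [hcol, hw.2]; simp⟩
    · intro w hw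
      rw [Finset.mem_filter] at *
      exact ⟨flipAt_mem_subcube hd hw.1, by rw [hcol]; cases h : col w <;> cases c <;> simp_all⟩
    · simp
    · simp
  rw [card_subcube, hD, pow_succ] at h1
  omega

include hcol in
theorem exists_subset_col {m p : ℕ} (hD : D.card = m + 1) (v : Fin n → Bool) (c : Bool)
    (E : Finset (Fin n → Bool)) (h : p + E.card ≤ 2 ^ m) :
    ∃ U ⊆ subcube D v, (∀ u ∈ U, col u = c) ∧ U.card = p ∧ Disjoint E U := by
  have h1 := card_filter_col hcol hD v c
  have h2 := Finset.le_card_sdiff E ((subcube D v).filter fun w => col w = c)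
  obtain ⟨U, hU, hp⟩ := Finset.exists_subset_card_eq (n := p)
    (s := ((subcube D v).filter fun w => col w = c) \ E) (by omega)
  refine ⟨U, fun u hu => ?_, fun u hu => ?_, hp, ?_⟩
  · exact (Finset.mem_filter.1 (Finset.mem_sdiff.1 (hU hu)).1).1
  · exact (Finset.mem_filter.1 (Finset.mem_sdiff.1 (hU hu)).1).2
  · rw [Finset.disjoint_right]
    exact fun u hu => (Finset.mem_sdiff.1 (hU hu)).2

include hcol in
/-- Vertices of the same colour that agree off one direction are equal. -/
theorem eq_of_col_eq (h : col v = col w) (d : Fin n) (hvw : ∀ i, i ≠ d → v i = w i) : v = w := by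
  by_contra hne
  have : v = flipAt d w := funext fun i => by
    by_cases hi : i = d
    · subst hi
      rw [flipAt_same]
      by_contra h'
      have h2 : v i = w i := by revert h'; cases v i <;> cases w i <;> simp
      exact hne (funext fun j => by
        by_cases hj : j = i
        · exact hj ▸ h2
        · exact hvw j hj)
    · rw [flipAt_of_ne hi, hvw i hi]
  rw [this, hcol] at h
  simp at h

include hcol in
-- Distinct vertices of one colour differ in at least two directions, so a prescribed direction can
-- be avoided.
theorem exists_direction (h : col v = col w) (hne : v ≠ w) {x : Fin n → Bool}
    (hv : v ∈ subcube D x) (hw : w ∈ subcube D x) (d₀ : Fin n) :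
    ∃ d ∈ D, d ≠ d₀ ∧ v d ≠ w d := by
  by_contra! hcon
  refine hne (eq_of_col_eq hcol h d₀ fun i hi => ?_)
  by_cases hiD : i ∈ D
  · exact hcon i hiD hi
  · rw [mem_subcube.1 hv i hiD, mem_subcube.1 hw i hiD]

include hcol in
theorem col_of_adj (h : (hypercubeGraph n).Adj v w) : col w = !col v := by
  obtain ⟨i, rfl⟩ := exists_eq_flipAt h
  exact hcol i v

variable {S T : Finset (Fin n → Bool)} {x : Fin n → Bool}

theorem filter_eq_subset_subcube (hd : d ∈ D) (hS : S ⊆ subcube D x) :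
    (S.filter fun w => w d = x d) ⊆ subcube (D.erase d) x := fun w hw => by
  rw [Finset.mem_filter] at hw
  exact (mem_subcube_erase hd).2 ⟨hS hw.1, hw.2⟩

theorem filter_ne_subset_subcube (hd : d ∈ D) (hS : S ⊆ subcube D x) :
    (S.filter fun w => ¬ w d = x d) ⊆ subcube (D.erase d) (flipAt d x) := fun w hw => by
  rw [Finset.mem_filter] at hw
  exact (mem_subcube_erase_flipAt hd).2 ⟨hS hw.1, hw.2⟩

/-- If `U` avoids the mirror images of the given sources `A`, then the mirror images of `U` are new
sources. -/
theorem disjoint_image_flipAt {A U : Finset (Fin n → Bool)} (h : Disjoint (A.image (flipAt d)) U) :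
    Disjoint A (U.image (flipAt d)) := by
  rw [Finset.disjoint_left] at *
  intro a ha ha'
  obtain ⟨u, hu, rfl⟩ := Finset.mem_image.1 ha'
  exact h (Finset.mem_image.2 ⟨_, ha, flipAt_flipAt d u⟩) hu

theorem forall_mem_union_col {col : (Fin n → Bool) → Bool} {A B : Finset (Fin n → Bool)} {c : Bool}
    (hA : ∀ a ∈ A, col a = c) (hB : ∀ a ∈ B, col a = c) : ∀ a ∈ A ∪ B, col a = c := fun a ha =>
  (Finset.mem_union.1 ha).elim (hA a) (hB a)

/-- Balanced disjoint path covers exist in all `m`-dimensional subcubes, for up to `max 1 (m - 1)`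
sources. -/
def SubcubeCoverable (col : (Fin n → Bool) → Bool) (m : ℕ) : Prop :=
  ∀ (D : Finset (Fin n)) (v : Fin n → Bool) (b : Bool) (S T : Finset (Fin n → Bool)),
    D.card = m → S ⊆ subcube D v → T ⊆ subcube D v → (∀ s ∈ S, col s = b) →
    (∀ t ∈ T, col t = !b) → S.card = T.card → 1 ≤ S.card → S.card ≤ max 1 (m - 1) →
    PathCover (hypercubeGraph n) (subcube D v) S T

include hcol in
theorem subcubeCoverable_one : SubcubeCoverable col 1 := by
  intro D v b S T hD hS hT hSb hTb hc h1 h2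
  obtain ⟨s, rfl⟩ := Finset.card_eq_one.1 (show S.card = 1 by simp at h2; omega)
  obtain ⟨t, rfl⟩ := Finset.card_eq_one.1 (show T.card = 1 by simpa using hc.symm)
  simp only [Finset.singleton_subset_iff, Finset.mem_singleton, forall_eq] at hS hT hSb hTb
  obtain ⟨d, rfl⟩ := Finset.card_eq_one.1 hD
  have hne : s ≠ t := by rintro rfl; simp [hSb] at hTb
  have hst : t = flipAt d s := by
    refine eq_of_col_eq hcol (by rw [hTb, hcol, hSb]) d fun i hi => ?_
    rw [flipAt_of_ne hi, mem_subcube.1 hS i (by simpa), mem_subcube.1 hT i (by simpa)]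
  have : subcube {d} v = {s, t} := by
    refine (Finset.eq_of_subset_of_card_le ?_ ?_).symm
    · intro w hw
      rw [Finset.mem_insert, Finset.mem_singleton] at hw
      rcases hw with rfl | rfl
      · exact hS
      · exact hT
    · rw [card_subcube, Finset.card_pair hne]; simp
  rw [this]
  exact PathCover.pair (hst ▸ adj_flipAt d s)

include hcol in
-- The half through `v` has a surplus of sources (possibly zero), which is sent across by `join`.
-- Only the targets of the other half can exceed the capacity, by one, and then `cut` is needed.
theorem subcube_step {m : ℕ} (hm : 1 ≤ m) (ih : SubcubeCoverable col m) {b : Bool}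
    (hD : D.card = m + 1) (hS : S ⊆ subcube D v)
    (hT : T ⊆ subcube D v) (hSb : ∀ s ∈ S, col s = b) (hTb : ∀ t ∈ T, col t = !b)
    (hc : S.card = T.card) (hk : S.card ≤ max 1 m) (hd : d ∈ D)
    (hle : (T.filter fun w => w d = v d).card ≤ (S.filter fun w => w d = v d).card)
    (h0 : 1 ≤ (S.filter fun w => w d = v d).card)
    (h0' : (S.filter fun w => w d = v d).card ≤ max 1 (m - 1))
    (h1 : 1 ≤ (T.filter fun w => ¬ w d = v d).card) :
    PathCover (hypercubeGraph n) (subcube D v) S T := by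
  obtain ⟨m, rfl⟩ : ∃ l, m = l + 1 := ⟨m - 1, by omega⟩
  have hD' : (D.erase d).card = m + 1 := by rw [Finset.card_erase_of_mem hd]; omega
  have hSu := Finset.filter_union_filter_not_eq (fun w => w d = v d) S
  have hTu := Finset.filter_union_filter_not_eq (fun w => w d = v d) T
  have hSc := Finset.card_filter_add_card_filter_not (s := S) (fun w => w d = v d)
  have hTc := Finset.card_filter_add_card_filter_not (s := T) (fun w => w d = v d)
  have hS0 := filter_eq_subset_subcube hd hS
  have hT0 := filter_eq_subset_subcube hd hT
  have hS1 := filter_ne_subset_subcube hd hS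
  have hT1 := filter_ne_subset_subcube hd hT
  have hS0b : ∀ s ∈ S.filter (fun w => w d = v d), col s = b := fun s hs =>
    hSb s (Finset.mem_filter.1 hs).1
  have hS1b : ∀ s ∈ S.filter (fun w => ¬ w d = v d), col s = b := fun s hs =>
    hSb s (Finset.mem_filter.1 hs).1
  have hT0b : ∀ s ∈ T.filter (fun w => w d = v d), col s = !b := fun s hs =>
    hTb s (Finset.mem_filter.1 hs).1
  have hT1b : ∀ s ∈ T.filter (fun w => ¬ w d = v d), col s = !b := fun s hs =>
    hTb s (Finset.mem_filter.1 hs).1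
  have hpow : m + 1 ≤ 2 ^ m := Nat.lt_two_pow_self
  have hkm : S.card ≤ m + 1 := by simpa using hk
  set S₀ := S.filter fun w => w d = v d
  set S₁ := S.filter fun w => ¬ w d = v d
  set T₀ := T.filter fun w => w d = v d
  set T₁ := T.filter fun w => ¬ w d = v d
  have himg := fun A : Finset (Fin n → Bool) => Finset.card_image_of_injective A (flipAt_injective d)
  have himgC : ∀ U ⊆ subcube (D.erase d) v, U.image (flipAt d) ⊆
      subcube (D.erase d) (flipAt d v) := fun U hU => by
    rw [Finset.image_subset_iff]
    exact fun u hu => flipAt_mem_subcube_flipAt hd (hU hu)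
  have himgb : ∀ U : Finset (Fin n → Bool), (∀ u ∈ U, col u = !b) →
      ∀ u ∈ U.image (flipAt d), col u = b := fun U hU u hu => by
    obtain ⟨w, hw, rfl⟩ := Finset.mem_image.1 hu
    rw [hcol, hU w hw, Bool.not_not]
  rw [subcube_eq_union hd v, ← hSu, ← hTu]
  by_cases ht1 : T₁.card ≤ max 1 m
  · obtain ⟨U, hU, hUb, hUc, hUE⟩ := exists_subset_col hcol (p := S₀.card - T₀.card) hD' v (!b)
      (T₀ ∪ S₁.image (flipAt d)) (by
        have := Finset.card_union_le T₀ (S₁.image (flipAt d))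
        rw [himg] at this
        omega)
    rw [Finset.disjoint_union_left] at hUE
    have e0 := Finset.card_union_of_disjoint hUE.1
    have e1 := Finset.card_union_of_disjoint (disjoint_image_flipAt hUE.2)
    rw [himg] at e1
    exact PathCover.join (flipAt_injective d) (adj_flipAt d)
      (ih _ v b _ _ hD' hS0 (Finset.union_subset hT0 hU) hS0b
        (forall_mem_union_col hT0b hUb) (by omega) h0 h0')
      (ih _ _ b _ _ hD' (Finset.union_subset hS1 (himgC U hU)) hT1
        (forall_mem_union_col hS1b (himgb U hUb)) hT1b
        (by omega) (by omega) (by simpa [show S₁.card + U.card = T₁.card by omega, e1] using ht1))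
      (disjoint_subcube_erase hd v) hUE.1 (disjoint_image_flipAt hUE.2)
  -- The capacity is exceeded only if every target lies in this half. One target `t` is dropped, so
  -- one crossing vertex fewer is chosen; the cut after `t` provides the last one.
  · have hT0e : T₀ = ∅ := Finset.card_eq_zero.1 (by omega)
    obtain ⟨U, hU, hUb, hUc, hUE⟩ := exists_subset_col hcol (p := S₀.card - 1) hD' v (!b)
      (S₁.image (flipAt d)) (by rw [himg]; omega)
    obtain ⟨t, ht⟩ := Finset.card_pos.1 h1
    have e1 := Finset.card_union_of_disjoint (disjoint_image_flipAt hUE)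
    rw [himg] at e1
    have e2 := Finset.card_erase_of_mem ht
    have hcov := ih _ _ b (S₁ ∪ U.image (flipAt d)) (T₁.erase t) hD'
      (Finset.union_subset hS1 (himgC U hU)) ((Finset.erase_subset _ _).trans hT1)
      (forall_mem_union_col hS1b (himgb U hUb)) (fun w hw => hT1b w (Finset.mem_of_mem_erase hw))
      (by rw [hT0e, Finset.card_empty] at hTc; omega) (by omega) (by
        rw [hT0e, Finset.card_empty] at hTc; omega)
    obtain ⟨z, hz, hzS, hz3, hcov⟩ := hcov.cut (hT1 ht) (by simp)
    rw [Finset.insert_erase ht] at hcov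
    have hzb : col z = b := by rw [col_of_adj hcol hz3, hT1b t ht, Bool.not_not]
    have hfz : flipAt d z ∉ U := fun h => hzS (Finset.mem_union_right _
      (Finset.mem_image.2 ⟨_, h, flipAt_flipAt d z⟩))
    have hzi : (insert (flipAt d z) U).image (flipAt d) = insert z (U.image (flipAt d)) := by
      rw [Finset.image_insert, flipAt_flipAt]
    have hins : insert z (S₁ ∪ U.image (flipAt d)) =
        S₁ ∪ (insert (flipAt d z) U).image (flipAt d) := by
      rw [hzi, Finset.union_insert]
    rw [hins] at hcov
    refine PathCover.join (U := insert (flipAt d z) U) (flipAt_injective d) (adj_flipAt d)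
      (ih _ v b _ _ hD' hS0 ?_ hS0b ?_ ?_ h0 h0') hcov
      (disjoint_subcube_erase hd v) ?_ ?_
    · rw [hT0e, Finset.empty_union]
      exact Finset.insert_subset (flipAt_mem_subcube_of_flipAt hd hz) hU
    · rw [hT0e, Finset.empty_union]
      intro w hw
      rcases Finset.mem_insert.1 hw with rfl | hw
      · rw [hcol, hzb]
      · exact hUb w hw
    · rw [hT0e, Finset.empty_union, Finset.card_insert_of_notMem hfz]
      omega
    · rw [hT0e]; exact Finset.disjoint_empty_left _
    · rw [hzi, Finset.disjoint_insert_right]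
      exact ⟨fun h => hzS (Finset.mem_union_left _ h), disjoint_image_flipAt hUE⟩

include hcol in
theorem subcubeCoverable {m : ℕ} (hm : 1 ≤ m) : SubcubeCoverable col m := by
  induction m, hm using Nat.le_induction with
  | base => exact subcubeCoverable_one hcol
  | succ m hm ih =>
    intro D v b S T hD hS hT hSb hTb hc h1 hk
    simp only [Nat.add_sub_cancel] at hk
    -- The base point `u` decides which half counts as the first; replacing `v` by `flipAt d v`
    -- exchanges the halves.
    have main : ∀ d ∈ D, ∀ u : Fin n → Bool, subcube D u = subcube D v →
        (T.filter fun w => w d = u d).card ≤ (S.filter fun w => w d = u d).card →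
        1 ≤ (S.filter fun w => w d = u d).card →
        (S.filter fun w => w d = u d).card ≤ max 1 (m - 1) →
        1 ≤ (T.filter fun w => ¬ w d = u d).card →
        PathCover (hypercubeGraph n) (subcube D v) S T := fun d hd u hu h2 h3 h4 h5 => by
      rw [← hu] at hS hT ⊢
      exact subcube_step hcol hm ih hD hS hT hSb hTb hc hk hd h2 h3 h4 h5
    have hfl : ∀ (d : Fin n) (A : Finset (Fin n → Bool)),
        A.filter (fun w => w d = flipAt d v d) = A.filter (fun w => ¬ w d = v d) := fun d A => by
      refine Finset.filter_congr fun w _ => ?_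
      rw [flipAt_same]; cases w d <;> cases v d <;> simp
    have hfl' : ∀ (d : Fin n) (A : Finset (Fin n → Bool)),
        A.filter (fun w => ¬ w d = flipAt d v d) = A.filter (fun w => w d = v d) := fun d A => by
      refine Finset.filter_congr fun w _ => ?_
      rw [flipAt_same]; cases w d <;> cases v d <;> simp
    -- With several sources, `d` separates two of them, so neither half contains all. With a single
    -- source, `d` separates it from its target, so the path must cross.
    obtain ⟨d, hd, hS', hall⟩ : ∃ d ∈ D, (2 ≤ S.card →
        (1 ≤ (S.filter fun w => w d = v d).card ∧ 1 ≤ (S.filter fun w => ¬ w d = v d).card)) ∧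
        (S.card = 1 → (S.filter fun w => w d = v d).card ≠ (T.filter fun w => w d = v d).card) := by
      rcases h1.eq_or_lt with h1 | h1
      · obtain ⟨s, rfl⟩ := Finset.card_eq_one.1 h1.symm
        obtain ⟨t, rfl⟩ := Finset.card_eq_one.1 (hc.symm.trans h1.symm)
        simp only [Finset.singleton_subset_iff, Finset.mem_singleton, forall_eq] at hS hT hSb hTb
        have hne : s ≠ t := by rintro rfl; simp [hSb] at hTb
        obtain ⟨d, hd⟩ := Function.ne_iff.1 hne
        refine ⟨d, ?_, by simp, fun _ => ?_⟩
        · by_contra hdD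
          rw [mem_subcube.1 hS d hdD, mem_subcube.1 hT d hdD] at hd
          exact hd rfl
        · simp only [Finset.filter_singleton]
          revert hd
          cases s d <;> cases t d <;> cases v d <;> simp
      · obtain ⟨s, hs, s', hs', hne⟩ := Finset.one_lt_card.1 h1
        obtain ⟨d0, hd0⟩ : D.Nonempty := Finset.card_pos.1 (by omega)
        obtain ⟨d, hd, -, hdd⟩ := exists_direction hcol (by rw [hSb s hs, hSb s' hs']) hne
          (hS hs) (hS hs') d0
        refine ⟨d, hd, fun _ => ?_, fun h => by omega⟩
        rw [Nat.one_le_iff_ne_zero, Nat.one_le_iff_ne_zero, ← Nat.pos_iff_ne_zero,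
          ← Nat.pos_iff_ne_zero, Finset.card_pos, Finset.card_pos]
        by_cases h : s d = v d
        · exact ⟨⟨s, by simp [hs, h]⟩, ⟨s', by simp [hs', ← h, Ne.symm hdd]⟩⟩
        · refine ⟨⟨s', ?_⟩, ⟨s, by simp [hs, h]⟩⟩
          rw [Finset.mem_filter]
          refine ⟨hs', ?_⟩
          revert h hdd
          cases s d <;> cases s' d <;> cases v d <;> simp
    have hSc := Finset.card_filter_add_card_filter_not (s := S) (fun w => w d = v d)
    have hTc := Finset.card_filter_add_card_filter_not (s := T) (fun w => w d = v d)
    rcases le_total (T.filter fun w => w d = v d).card (S.filter fun w => w d = v d).card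
      with hle | hle
    · exact main d hd v rfl hle (by omega) (by omega) (by omega)
    · exact main d hd (flipAt d v) (subcube_flipAt hd v) (by rw [hfl, hfl]; omega)
        (by rw [hfl]; omega) (by rw [hfl]; omega) (by rw [hfl']; omega)

end Subcube

/-! ### Covers of subcubes without an edge. -/

section Punctured

variable {n : ℕ} {D : Finset (Fin n)} {v w x : Fin n → Bool} {d d₀ : Fin n}
  {S T : Finset (Fin n → Bool)} {b : Bool} {m : ℕ}

/-- The subcube through `x` without the edge at `x` in direction `d₀`. -/
def puncturedSubcube (D : Finset (Fin n)) (x : Fin n → Bool) (d₀ : Fin n) :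
    Finset (Fin n → Bool) :=
  subcube D x \ {x, flipAt d₀ x}

theorem mem_puncturedSubcube :
    w ∈ puncturedSubcube D x d₀ ↔ w ∈ subcube D x ∧ w ≠ x ∧ w ≠ flipAt d₀ x := by
  simp [puncturedSubcube]

theorem puncturedSubcube_subset : puncturedSubcube D x d₀ ⊆ subcube D x := Finset.sdiff_subset

theorem filter_eq_subset_puncturedSubcube (hd : d ∈ D) (hS : S ⊆ puncturedSubcube D x d₀) :
    (S.filter fun w => w d = x d) ⊆ puncturedSubcube (D.erase d) x d₀ := fun w hw => by
  have h := filter_eq_subset_subcube hd (hS.trans puncturedSubcube_subset) hw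
  rw [Finset.mem_filter] at hw
  exact mem_puncturedSubcube.2 ⟨h, (mem_puncturedSubcube.1 (hS hw.1)).2⟩

theorem puncturedSubcube_eq_union (hd : d ∈ D) (hne : d ≠ d₀) (x : Fin n → Bool) :
    puncturedSubcube D x d₀ =
      puncturedSubcube (D.erase d) x d₀ ∪ subcube (D.erase d) (flipAt d x) := by
  ext w
  rw [Finset.mem_union, mem_puncturedSubcube, mem_puncturedSubcube, mem_subcube_erase hd,
    mem_subcube_erase_flipAt hd]
  by_cases h : w d = x d
  · tauto
  · have h1 : w ≠ x := by rintro rfl; exact h rfl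
    have h2 : w ≠ flipAt d₀ x := by rintro rfl; exact h (flipAt_of_ne hne x)
    tauto

theorem disjoint_puncturedSubcube (hd : d ∈ D) (d₀ : Fin n) (x : Fin n → Bool) :
    Disjoint (puncturedSubcube (D.erase d) x d₀) (subcube (D.erase d) (flipAt d x)) :=
  Finset.disjoint_of_subset_left puncturedSubcube_subset (disjoint_subcube_erase hd x)

theorem exists_ne_of_mem_puncturedSubcube (h : w ∈ puncturedSubcube D x d₀) :
    ∃ d ∈ D, d ≠ d₀ ∧ w d ≠ x d := by
  by_contra! hcon
  obtain ⟨h1, h2, h3⟩ := mem_puncturedSubcube.1 h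
  have hag : ∀ i, i ≠ d₀ → w i = x i := fun i hi => by
    by_cases hiD : i ∈ D
    · exact hcon i hiD hi
    · exact mem_subcube.1 h1 i hiD
  by_cases h0 : w d₀ = x d₀
  · exact h2 (funext fun i => by
      by_cases hi : i = d₀
      · rw [hi, h0]
      · exact hag i hi)
  · refine h3 (funext fun i => ?_)
    by_cases hi : i = d₀
    · rw [hi, flipAt_same]
      revert h0
      cases w d₀ <;> cases x d₀ <;> simp
    · rw [flipAt_of_ne hi, hag i hi]

theorem flipAt_mem_puncturedSubcube (hd : d₀ ∈ D) (h : w ∈ puncturedSubcube D x d₀) :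
    flipAt d₀ w ∈ puncturedSubcube D x d₀ := by
  obtain ⟨h1, h2, h3⟩ := mem_puncturedSubcube.1 h
  refine mem_puncturedSubcube.2 ⟨flipAt_mem_subcube hd h1, ?_, ?_⟩
  · rintro rfl
    exact h3 (flipAt_flipAt d₀ w).symm
  · exact fun h => h2 (flipAt_injective d₀ h)

theorem puncturedCover_two (hD : D.card = 2) (hd : d₀ ∈ D) (h : w ∈ puncturedSubcube D x d₀) :
    PathCover (hypercubeGraph n) (puncturedSubcube D x d₀) {w} {flipAt d₀ w} := by
  have hne : ∀ v : Fin n → Bool, v ≠ flipAt d₀ v := fun v => (adj_flipAt d₀ v).ne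
  have : puncturedSubcube D x d₀ = {w, flipAt d₀ w} := by
    refine (Finset.eq_of_subset_of_card_le ?_ ?_).symm
    · intro u hu
      rw [Finset.mem_insert, Finset.mem_singleton] at hu
      rcases hu with rfl | rfl
      · exact h
      · exact flipAt_mem_puncturedSubcube hd h
    · have hsub : ({x, flipAt d₀ x} : Finset (Fin n → Bool)) ⊆ subcube D x := by
        intro u hu
        rw [Finset.mem_insert, Finset.mem_singleton] at hu
        rcases hu with rfl | rfl
        · exact self_mem_subcube
        · exact flipAt_mem_subcube hd self_mem_subcube
      rw [puncturedSubcube, Finset.card_sdiff_of_subset hsub, card_subcube, hD,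
        Finset.card_pair (hne x), Finset.card_pair (hne w)]
      norm_num
  rw [this]
  exact PathCover.pair (adj_flipAt d₀ w)

variable {col : (Fin n → Bool) → Bool} (hcol : ∀ i v, col (flipAt i v) = !col v)

include hcol in
theorem card_edge_filter_col (x : Fin n → Bool) (d₀ : Fin n) (c : Bool) :
    (({x, flipAt d₀ x} : Finset (Fin n → Bool)).filter fun w => col w = c).card ≤ 1 := by
  refine Finset.card_le_one.2 fun v hv w hw => ?_
  rw [Finset.mem_filter, Finset.mem_insert, Finset.mem_singleton] at hv hw
  refine eq_of_col_eq hcol (hv.2.trans hw.2.symm) d₀ fun i hi => ?_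
  rcases hv.1 with rfl | rfl <;> rcases hw.1 with rfl | rfl <;> simp [flipAt_of_ne hi]

include hcol in
/-- Vertices of the same colour opposite to the removed edge coincide. -/
theorem eq_of_opposite (hv : v ∈ subcube D x) (hw : w ∈ subcube D x) (h : col v = col w)
    (hv' : ∀ i ∈ D, i ≠ d₀ → v i ≠ x i) (hw' : ∀ i ∈ D, i ≠ d₀ → w i ≠ x i) : v = w := by
  refine eq_of_col_eq hcol h d₀ fun i hi => ?_
  by_cases hiD : i ∈ D
  · have h1 := hv' i hiD hi
    have h2 := hw' i hiD hi
    revert h1 h2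
    cases v i <;> cases w i <;> cases x i <;> simp
  · rw [mem_subcube.1 hv i hiD, mem_subcube.1 hw i hiD]

include hcol in
-- The summand 2 pays for at most one vertex of colour `c` on the removed edge and at most one on
-- the opposite edge. Avoiding the latter secures the extra condition for `m = 3`.
theorem exists_subset_punctured {p : ℕ} (hD : D.card = m + 1) (x : Fin n → Bool) (d₀ : Fin n)
    (c : Bool) (E : Finset (Fin n → Bool)) (h : p + E.card + 2 ≤ 2 ^ m) :
    ∃ U ⊆ puncturedSubcube D x d₀, (∀ u ∈ U, col u = c) ∧ U.card = p ∧ Disjoint E U ∧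
      ∀ u ∈ U, ∃ i ∈ D, i ≠ d₀ ∧ u i = x i := by
  let Z := ({x, flipAt d₀ x} : Finset (Fin n → Bool)).filter fun w => col w = c
  let O := (subcube D x).filter fun w => col w = c ∧ ∀ i ∈ D, i ≠ d₀ → w i ≠ x i
  have hZ : Z.card ≤ 1 := card_edge_filter_col hcol x d₀ c
  have hO : O.card ≤ 1 := by
    refine Finset.card_le_one.2 fun v hv w hw => ?_
    rw [Finset.mem_filter] at hv hw
    exact eq_of_opposite hcol hv.1 hw.1 (hv.2.1.trans hw.2.1.symm) hv.2.2 hw.2.2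
  obtain ⟨U, hU, hUc, hUp, hUE⟩ := exists_subset_col hcol (p := p) hD x c (E ∪ (Z ∪ O)) (by
    have h1 := Finset.card_union_le E (Z ∪ O)
    have h2 := Finset.card_union_le Z O
    omega)
  rw [Finset.disjoint_union_left, Finset.disjoint_union_left] at hUE
  refine ⟨U, fun u hu => ?_, hUc, hUp, hUE.1, fun u hu => ?_⟩
  · have := Finset.disjoint_right.1 hUE.2.1 hu
    simp only [Z, Finset.mem_filter, hUc u hu, and_true, Finset.mem_insert,
      Finset.mem_singleton, not_or] at this
    exact mem_puncturedSubcube.2 ⟨hU hu, this⟩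
  · by_contra! hcon
    exact Finset.disjoint_right.1 hUE.2.2 hu (Finset.mem_filter.2 ⟨hU hu, hUc u hu, hcon⟩)

/-- Balanced disjoint path covers exist in all `m`-dimensional subcubes without an edge, for up to
`m - 2` sources; for `m = 3` not all the ends may be opposite to the removed edge. -/
def PuncturedCoverable (col : (Fin n → Bool) → Bool) (m : ℕ) : Prop :=
  ∀ (D : Finset (Fin n)) (x : Fin n → Bool) (d₀ : Fin n) (b : Bool)
    (S T : Finset (Fin n → Bool)), D.card = m → d₀ ∈ D →
    S ⊆ puncturedSubcube D x d₀ → T ⊆ puncturedSubcube D x d₀ → (∀ s ∈ S, col s = b) →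
    (∀ t ∈ T, col t = !b) → S.card = T.card → 1 ≤ S.card → S.card + 2 ≤ m →
    (4 ≤ m ∨ ∃ v ∈ S ∪ T, ∃ i ∈ D, i ≠ d₀ ∧ v i = x i) →
    PathCover (hypercubeGraph n) (puncturedSubcube D x d₀) S T

include hcol in
-- The punctured half is a single edge. The path traverses it from `s`, crosses over, and runs
-- through the whole square on the other side to `t`.
theorem puncturedCover_three_of_ne {s t : Fin n → Bool} (hD : D.card = 3) (hd₀ : d₀ ∈ D)
    (hs : s ∈ puncturedSubcube D x d₀) (ht : t ∈ puncturedSubcube D x d₀)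
    (hst : col t = !col s) (hd : d ∈ D) (hne : d ≠ d₀) (hsd : s d = x d) (htd : t d ≠ x d) :
    PathCover (hypercubeGraph n) (puncturedSubcube D x d₀) {s} {t} := by
  have hD' : (D.erase d).card = 2 := by rw [Finset.card_erase_of_mem hd, hD]
  have hs' : s ∈ puncturedSubcube (D.erase d) x d₀ :=
    filter_eq_subset_puncturedSubcube (S := {s}) hd (by simpa using hs) (by simp [hsd])
  have hd₀' : d₀ ∈ D.erase d := Finset.mem_erase.2 ⟨hne.symm, hd₀⟩
  have h0 := puncturedCover_two hD' hd₀' hs'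
  have h1 := subcubeCoverable hcol (m := 2) (by norm_num) (D.erase d) (flipAt d x) (col s)
    {flipAt d (flipAt d₀ s)} {t} hD'
    (by
      rw [Finset.singleton_subset_iff]
      exact flipAt_mem_subcube_flipAt hd (puncturedSubcube_subset
        (flipAt_mem_puncturedSubcube hd₀' hs')))
    (by
      rw [Finset.singleton_subset_iff]
      exact (mem_subcube_erase_flipAt hd).2 ⟨puncturedSubcube_subset ht, htd⟩)
    (by simp [hcol]) (by simp [hst]) (by simp) (by simp) (by simp)
  rw [puncturedSubcube_eq_union hd hne]
  have := PathCover.join (U := {flipAt d₀ s}) (T₀ := ∅) (S₁ := ∅) (flipAt_injective d)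
    (adj_flipAt d) (by simpa using h0) (by simpa using h1) (disjoint_puncturedSubcube hd d₀ x)
    (by simp) (by simp)
  simpa using this

include hcol in
theorem puncturedCoverable_three : PuncturedCoverable col 3 := by
  intro D x d₀ b S T hD hd₀ hS hT hSb hTb hc h1 hk hex
  obtain ⟨s, rfl⟩ := Finset.card_eq_one.1 (show S.card = 1 by omega)
  obtain ⟨t, rfl⟩ := Finset.card_eq_one.1 (show T.card = 1 by simpa using hc.symm)
  simp only [Finset.singleton_subset_iff, Finset.mem_singleton, forall_eq] at hS hT hSb hTb
  subst hSb
  by_cases hsep : ∃ d ∈ D, d ≠ d₀ ∧ s d ≠ t d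
  · obtain ⟨d, hd, hne, hst⟩ := hsep
    by_cases hsd : s d = x d
    · exact puncturedCover_three_of_ne hcol hD hd₀ hS hT hTb hd hne hsd (hsd ▸ hst.symm)
    · refine (puncturedCover_three_of_ne hcol hD hd₀ hT hS ?_ hd hne ?_ hsd).symm
      · rw [hTb, Bool.not_not]
      · revert hsd hst
        cases s d <;> cases t d <;> cases x d <;> simp
  · push Not at hsep
    have hts : t = flipAt d₀ s := by
      refine eq_of_col_eq hcol (by rw [hTb, hcol]) d₀ fun i hi => ?_
      rw [flipAt_of_ne hi]
      by_cases hiD : i ∈ D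
      · exact (hsep i hiD hi).symm
      · rw [mem_subcube.1 (puncturedSubcube_subset hS) i hiD,
          mem_subcube.1 (puncturedSubcube_subset hT) i hiD]
    obtain ⟨d, hd, hne, hsd⟩ : ∃ d ∈ D, d ≠ d₀ ∧ s d = x d := by
      rcases hex with h | ⟨v, hv, i, hi, hid, hvi⟩
      · omega
      · refine ⟨i, hi, hid, ?_⟩
        rw [Finset.mem_union, Finset.mem_singleton, Finset.mem_singleton] at hv
        rcases hv with rfl | rfl
        · exact hvi
        · rw [hsep i hi hid, hvi]
    have hD' : (D.erase d).card = 2 := by rw [Finset.card_erase_of_mem hd, hD]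
    have hs' : s ∈ puncturedSubcube (D.erase d) x d₀ :=
      filter_eq_subset_puncturedSubcube (S := {s}) hd (by simpa using hS) (by simp [hsd])
    -- Here `s` and `t` form the edge left in the punctured half; it is replaced by a detour through
    -- the other square.
    rw [puncturedSubcube_eq_union hd hne, hts]
    refine (puncturedCover_two hD' (Finset.mem_erase.2 ⟨hne.symm, hd₀⟩) hs').detour
      (A := {s}) (B := ∅) (disjoint_puncturedSubcube hd d₀ x) (by simpa using hs') ?_ (by simp) ?_
    · simpa using (adj_flipAt d₀ s).ne
    · intro a ha c hcC _ _ hac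
      obtain rfl := Finset.mem_singleton.1 ha
      refine ⟨flipAt d a, flipAt d c, adj_flipAt d a, (adj_flipAt d c).symm, ?_⟩
      refine subcubeCoverable hcol (m := 2) (by norm_num) (D.erase d) (flipAt d x) (!col a) _ _ hD'
        ?_ ?_ ?_ ?_ (by simp) (by simp) (by simp)
      · rw [Finset.singleton_subset_iff]
        exact flipAt_mem_subcube_flipAt hd (puncturedSubcube_subset hs')
      · rw [Finset.singleton_subset_iff]
        exact flipAt_mem_subcube_flipAt hd (puncturedSubcube_subset hcC)
      · simp [hcol]
      · simp [hcol, col_of_adj hcol hac]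

include hcol in
-- The surplus sources of the punctured half leave through `U`. Since `U` is nonempty and avoids the
-- opposite edge, the extra condition holds automatically, and the full half has room for all
-- targets.
theorem punctured_cross (hm : 3 ≤ m) (ih : PuncturedCoverable col m) (hD : D.card = m + 1)
    (hd₀ : d₀ ∈ D) (hd : d ∈ D) (hne : d ≠ d₀)
    (hS : S ⊆ puncturedSubcube D x d₀) (hT : T ⊆ puncturedSubcube D x d₀)
    (hSb : ∀ s ∈ S, col s = b) (hTb : ∀ t ∈ T, col t = !b) (hc : S.card = T.card)
    (hk : S.card + 1 ≤ m)
    (hlt : (T.filter fun w => w d = x d).card < (S.filter fun w => w d = x d).card)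
    (hle : (S.filter fun w => w d = x d).card + 2 ≤ m) :
    PathCover (hypercubeGraph n) (puncturedSubcube D x d₀) S T := by
  obtain ⟨m, rfl⟩ : ∃ l, m = l + 1 := ⟨m - 1, by omega⟩
  have hD' : (D.erase d).card = m + 1 := by rw [Finset.card_erase_of_mem hd]; omega
  have hSu := Finset.filter_union_filter_not_eq (fun w => w d = x d) S
  have hTu := Finset.filter_union_filter_not_eq (fun w => w d = x d) T
  have hSc := Finset.card_filter_add_card_filter_not (s := S) (fun w => w d = x d)
  have hTc := Finset.card_filter_add_card_filter_not (s := T) (fun w => w d = x d)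
  have hS0 := filter_eq_subset_puncturedSubcube hd hS
  have hT0 := filter_eq_subset_puncturedSubcube hd hT
  have hS1 := filter_ne_subset_subcube hd (hS.trans puncturedSubcube_subset)
  have hT1 := filter_ne_subset_subcube hd (hT.trans puncturedSubcube_subset)
  have hfb : ∀ {A : Finset (Fin n → Bool)} {c : Bool} (q : (Fin n → Bool) → Prop)
      [DecidablePred q], (∀ a ∈ A, col a = c) → ∀ a ∈ A.filter q, col a = c :=
    fun q _ h a ha => h a (Finset.mem_filter.1 ha).1
  have hS0b := hfb (fun w => w d = x d) hSb
  have hS1b := hfb (fun w => ¬ w d = x d) hSb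
  have hT0b := hfb (fun w => w d = x d) hTb
  have hT1b := hfb (fun w => ¬ w d = x d) hTb
  have hpow : m + 2 ≤ 2 ^ m := by
    obtain ⟨l, rfl⟩ : ∃ l, m = l + 2 := ⟨m - 2, by omega⟩
    have : l + 1 ≤ 2 ^ l := Nat.lt_two_pow_self
    rw [pow_add]; omega
  have himg := fun A : Finset (Fin n → Bool) => Finset.card_image_of_injective A (flipAt_injective d)
  set S₀ := S.filter fun w => w d = x d
  set S₁ := S.filter fun w => ¬ w d = x d
  set T₀ := T.filter fun w => w d = x d
  set T₁ := T.filter fun w => ¬ w d = x d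
  obtain ⟨U, hU, hUb, hUc, hUE, hUx⟩ := exists_subset_punctured hcol (p := S₀.card - T₀.card) hD'
    x d₀ (!b) (T₀ ∪ S₁.image (flipAt d)) (by
      have := Finset.card_union_le T₀ (S₁.image (flipAt d))
      rw [himg] at this
      omega)
  rw [Finset.disjoint_union_left] at hUE
  have e0 := Finset.card_union_of_disjoint hUE.1
  have e1 := Finset.card_union_of_disjoint (disjoint_image_flipAt hUE.2)
  rw [himg] at e1
  rw [puncturedSubcube_eq_union hd hne, ← hSu, ← hTu]
  refine PathCover.join (flipAt_injective d) (adj_flipAt d)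
    (ih _ x d₀ b _ _ hD' (Finset.mem_erase.2 ⟨hne.symm, hd₀⟩) hS0 (Finset.union_subset hT0 hU) hS0b
      (forall_mem_union_col hT0b hUb) (by omega) (by omega) hle ?_)
    (subcubeCoverable hcol (by omega) _ _ b _ _ hD' (Finset.union_subset hS1 ?_) hT1
      (forall_mem_union_col hS1b ?_) hT1b (by omega) (by omega) (by omega))
    (disjoint_puncturedSubcube hd d₀ x) hUE.1 (disjoint_image_flipAt hUE.2)
  · obtain ⟨u, hu⟩ := Finset.card_pos.1 (show 0 < U.card by omega)
    exact Or.inr ⟨u, by simp [hu], hUx u hu⟩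
  · rw [Finset.image_subset_iff]
    exact fun u hu => flipAt_mem_subcube_flipAt hd (puncturedSubcube_subset (hU hu))
  · intro u hu
    obtain ⟨w, hw, rfl⟩ := Finset.mem_image.1 hu
    rw [hcol, hUb w hw, Bool.not_not]

include hcol in
-- All ends lie in the full half. A cover of it is rerouted along one edge through the punctured
-- half. Two candidates for the start of that edge suffice, because at most one successor has its
-- mirror image on the removed edge.
theorem punctured_detour (hm : 3 ≤ m) (ih : PuncturedCoverable col m) (hD : D.card = m + 1)
    (hd₀ : d₀ ∈ D) (hd : d ∈ D) (hne : d ≠ d₀)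
    (hS : S ⊆ subcube (D.erase d) (flipAt d x)) (hT : T ⊆ subcube (D.erase d) (flipAt d x))
    (hSb : ∀ s ∈ S, col s = b) (hTb : ∀ t ∈ T, col t = !b) (hc : S.card = T.card)
    (h1 : 1 ≤ S.card) (hk : S.card + 1 ≤ m) :
    PathCover (hypercubeGraph n) (puncturedSubcube D x d₀) S T := by
  obtain ⟨m, rfl⟩ : ∃ l, m = l + 1 := ⟨m - 1, by omega⟩
  have hD' : (D.erase d).card = m + 1 := by rw [Finset.card_erase_of_mem hd]; omega
  have hpow : 2 + 2 ≤ 2 ^ m :=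
    calc 2 + 2 = 2 ^ 2 := by norm_num
      _ ≤ 2 ^ m := Nat.pow_le_pow_right (by norm_num) (by omega)
  obtain ⟨U, hU, hUb, hUc, -, hUx⟩ := exists_subset_punctured hcol (p := 2) hD' x d₀ (!b) ∅
    (by simpa using hpow)
  rw [puncturedSubcube_eq_union hd hne, Finset.union_comm]
  have hUmem : ∀ a ∈ U.image (flipAt d), flipAt d a ∈ U := fun a ha => by
    obtain ⟨u, hu, rfl⟩ := Finset.mem_image.1 ha
    rwa [flipAt_flipAt]
  refine (subcubeCoverable hcol (by omega) _ _ b S T hD' hS hT hSb hTb hc h1 (by omega)).detour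
    (A := U.image (flipAt d))
    (B := (({x, flipAt d₀ x} : Finset (Fin n → Bool)).filter fun w => col w = b).image (flipAt d))
    (disjoint_puncturedSubcube hd d₀ x).symm ?_ ?_ ?_ ?_
  · rw [Finset.image_subset_iff]
    exact fun u hu => flipAt_mem_subcube_flipAt hd (puncturedSubcube_subset (hU hu))
  · rw [Finset.disjoint_left]
    intro a ha haT
    have := hUb _ (hUmem a ha)
    rw [hcol, hTb a haT] at this
    simp at this
  · rw [Finset.card_image_of_injective _ (flipAt_injective d),
      Finset.card_image_of_injective _ (flipAt_injective d), hUc]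
    exact Nat.lt_succ_of_le (card_edge_filter_col hcol x d₀ b)
  · intro a ha c hcC _ hcB hac
    have hau := hUmem a ha
    have hcc : col (flipAt d c) = b := by
      rw [hcol, col_of_adj hcol hac, ← hcol d a, hUb _ hau, Bool.not_not]
    refine ⟨flipAt d a, flipAt d c, adj_flipAt d a, (adj_flipAt d c).symm, ?_⟩
    refine ih _ x d₀ (!b) _ _ hD' (Finset.mem_erase.2 ⟨hne.symm, hd₀⟩) ?_ ?_ ?_ ?_ (by simp)
      (by simp) (by simpa using hm) (Or.inr ⟨flipAt d a, by simp, hUx _ hau⟩)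
    · rw [Finset.singleton_subset_iff]
      exact hU hau
    · rw [Finset.singleton_subset_iff, mem_puncturedSubcube, ← not_or]
      refine ⟨flipAt_mem_subcube_of_flipAt hd hcC, fun h => hcB ?_⟩
      refine Finset.mem_image.2 ⟨flipAt d c, Finset.mem_filter.2 ⟨?_, hcc⟩, flipAt_flipAt d c⟩
      simpa using h
    · simpa using hUb _ hau
    · simpa using hcc

include hcol in
-- Unequal numbers of sources and targets in the punctured half call for crossing paths, in one of
-- the two orientations. With equal numbers the halves are covered separately, or by a detour if the
-- punctured half has no ends; only the separate covers need `hex`.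
theorem punctured_step (hm : 3 ≤ m) (ih : PuncturedCoverable col m) (hD : D.card = m + 1)
    (hd₀ : d₀ ∈ D) (hd : d ∈ D) (hne : d ≠ d₀)
    (hS : S ⊆ puncturedSubcube D x d₀) (hT : T ⊆ puncturedSubcube D x d₀)
    (hSb : ∀ s ∈ S, col s = b) (hTb : ∀ t ∈ T, col t = !b) (hc : S.card = T.card)
    (h1 : 1 ≤ S.card) (hk : S.card + 1 ≤ m)
    (hSle : (S.filter fun w => w d = x d).card + 2 ≤ m)
    (hTle : (T.filter fun w => w d = x d).card + 2 ≤ m)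
    (hS1 : 1 ≤ (S.filter fun w => ¬ w d = x d).card)
    (hex : 4 ≤ m ∨ (S.filter fun w => w d = x d).card = 0 ∨
      ∃ v ∈ S ∪ T, v d = x d ∧ ∃ i ∈ D.erase d, i ≠ d₀ ∧ v i = x i) :
    PathCover (hypercubeGraph n) (puncturedSubcube D x d₀) S T := by
  have hD' : (D.erase d).card = m := by rw [Finset.card_erase_of_mem hd]; omega
  have hSc := Finset.card_filter_add_card_filter_not (s := S) (fun w => w d = x d)
  have hTc := Finset.card_filter_add_card_filter_not (s := T) (fun w => w d = x d)
  have hSu := Finset.filter_union_filter_not_eq (fun w => w d = x d) S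
  have hTu := Finset.filter_union_filter_not_eq (fun w => w d = x d) T
  have hS1' := filter_ne_subset_subcube hd (hS.trans puncturedSubcube_subset)
  have hT1' := filter_ne_subset_subcube hd (hT.trans puncturedSubcube_subset)
  rcases lt_trichotomy (T.filter fun w => w d = x d).card (S.filter fun w => w d = x d).card
    with h | h | h
  · exact punctured_cross hcol hm ih hD hd₀ hd hne hS hT hSb hTb hc hk h hSle
  · by_cases h0 : (S.filter fun w => w d = x d).card = 0
    · have hS0 := Finset.card_eq_zero.1 h0
      have hT0 := Finset.card_eq_zero.1 (h.trans h0)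
      rw [hS0, Finset.empty_union] at hSu
      rw [hT0, Finset.empty_union] at hTu
      rw [hSu] at hS1'
      rw [hTu] at hT1'
      exact punctured_detour hcol hm ih hD hd₀ hd hne hS1' hT1' hSb hTb hc h1 hk
    · rw [puncturedSubcube_eq_union hd hne, ← hSu, ← hTu]
      refine PathCover.union (flipAt_injective d) (adj_flipAt d)
        (ih _ x d₀ b _ _ hD' (Finset.mem_erase.2 ⟨hne.symm, hd₀⟩)
          (filter_eq_subset_puncturedSubcube hd hS) (filter_eq_subset_puncturedSubcube hd hT)
          (fun s hs => hSb s (Finset.mem_filter.1 hs).1)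
          (fun s hs => hTb s (Finset.mem_filter.1 hs).1) h.symm (by omega) hSle ?_)
        (subcubeCoverable hcol (by omega) _ _ b _ _ hD' hS1' hT1'
          (fun s hs => hSb s (Finset.mem_filter.1 hs).1)
          (fun s hs => hTb s (Finset.mem_filter.1 hs).1) (by omega) hS1 (by omega))
        (disjoint_puncturedSubcube hd d₀ x)
      rcases hex with hex | hex | ⟨v, hv, hvd, hvi⟩
      · exact Or.inl hex
      · exact absurd hex h0
      · rw [← Finset.filter_union]
        exact Or.inr ⟨v, Finset.mem_filter.2 ⟨hv, hvd⟩, hvi⟩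
  · exact (punctured_cross hcol hm ih hD hd₀ hd hne hT hS hTb (by simpa using hSb) hc.symm
      (by omega) h hTle).symm

include hcol in
/-- The case that all targets lie on the side of the removed edge. -/
theorem punctured_cut (hm : 3 ≤ m) (ih : PuncturedCoverable col m) (hD : D.card = m + 1)
    (hd₀ : d₀ ∈ D) (hd : d ∈ D) (hne : d ≠ d₀)
    (hS : S ⊆ puncturedSubcube D x d₀) (hT : T ⊆ puncturedSubcube D x d₀)
    (hSb : ∀ s ∈ S, col s = b) (hTb : ∀ t ∈ T, col t = !b) (hc : S.card = T.card)
    (hk : S.card + 1 = m)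
    (hS0 : 1 ≤ (S.filter fun w => w d = x d).card)
    (hS1 : 1 ≤ (S.filter fun w => ¬ w d = x d).card)
    (hTd : ∀ t ∈ T, t d = x d) :
    PathCover (hypercubeGraph n) (puncturedSubcube D x d₀) S T := by
  obtain ⟨m, rfl⟩ : ∃ l, m = l + 1 := ⟨m - 1, by omega⟩
  have hD' : (D.erase d).card = m + 1 := by rw [Finset.card_erase_of_mem hd]; omega
  have hd₀' : d₀ ∈ D.erase d := Finset.mem_erase.2 ⟨hne.symm, hd₀⟩
  have hSc := Finset.card_filter_add_card_filter_not (s := S) (fun w => w d = x d)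
  have hSu := Finset.filter_union_filter_not_eq (fun w => w d = x d) S
  have hS0' := filter_eq_subset_puncturedSubcube hd hS
  have hS1' := filter_ne_subset_subcube hd (hS.trans puncturedSubcube_subset)
  have hT' : T ⊆ puncturedSubcube (D.erase d) x d₀ := fun t ht =>
    filter_eq_subset_puncturedSubcube hd hT (Finset.mem_filter.2 ⟨ht, hTd t ht⟩)
  have hS0b : ∀ s ∈ S.filter (fun w => w d = x d), col s = b := fun s hs =>
    hSb s (Finset.mem_filter.1 hs).1
  have hS1b : ∀ s ∈ S.filter (fun w => ¬ w d = x d), col s = b := fun s hs =>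
    hSb s (Finset.mem_filter.1 hs).1
  set S₀ := S.filter fun w => w d = x d
  set S₁ := S.filter fun w => ¬ w d = x d
  obtain ⟨W, hW, hWb, hWc, hWE, -⟩ := exists_subset_punctured hcol (p := S₁.card - 1) hD' x d₀ b S₀
    (by
      have : m + 2 ≤ 2 ^ m := by
        obtain ⟨l, rfl⟩ : ∃ l, m = l + 2 := ⟨m - 2, by omega⟩
        have : l + 1 ≤ 2 ^ l := Nat.lt_two_pow_self
        rw [pow_add]; omega
      omega)
  -- At most one target is opposite to the removed edge. The target `t` to be dropped is chosen so
  -- that another one, `t'`, is not opposite and keeps the extra condition true.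
  obtain ⟨t, ht, t', ht', htt', hti⟩ : ∃ t ∈ T, ∃ t' ∈ T, t' ≠ t ∧
      ∃ i ∈ D.erase d, i ≠ d₀ ∧ t' i = x i := by
    obtain ⟨t, ht, t', ht', htt'⟩ := Finset.one_lt_card.1 (show 1 < T.card by omega)
    by_cases h : ∃ i ∈ D.erase d, i ≠ d₀ ∧ t' i = x i
    · exact ⟨t, ht, t', ht', htt'.symm, h⟩
    · refine ⟨t', ht', t, ht, htt', ?_⟩
      by_contra h'
      push Not at h h'
      exact htt' (eq_of_opposite hcol (puncturedSubcube_subset (hT' ht))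
        (puncturedSubcube_subset (hT' ht')) (by rw [hTb t ht, hTb t' ht']) h' h)
  have e1 := Finset.card_union_of_disjoint hWE
  have e2 := Finset.card_erase_of_mem ht
  have hcov := ih _ x d₀ b (S₀ ∪ W) (T.erase t) hD' hd₀' (Finset.union_subset hS0' hW)
    ((Finset.erase_subset _ _).trans hT') (forall_mem_union_col hS0b hWb)
    (fun w hw => hTb w (Finset.mem_of_mem_erase hw)) (by omega) (by omega) (by omega)
    (Or.inr ⟨t', by simp [ht', htt'], hti⟩)
  obtain ⟨z, hz, hzS, hz3, hcov⟩ := hcov.cut (hT' ht) (by simp)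
  rw [Finset.insert_erase ht] at hcov
  have hzb : col z = b := by rw [col_of_adj hcol hz3, hTb t ht, Bool.not_not]
  have hzW : z ∉ W := fun h => hzS (Finset.mem_union_right _ h)
  have hii : ((insert z W).image (flipAt d)).image (flipAt d) = insert z W := by
    rw [Finset.image_image, funext (flipAt_flipAt d) (f := flipAt d ∘ flipAt d) (g := id),
      Finset.image_id]
  have hcU : ((insert z W).image (flipAt d)).card = W.card + 1 := by
    rw [Finset.card_image_of_injective _ (flipAt_injective d), Finset.card_insert_of_notMem hzW]
  rw [puncturedSubcube_eq_union hd hne, Finset.union_comm, ← hSu, Finset.union_comm S₀ S₁,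
    ← Finset.empty_union T]
  refine PathCover.join (U := (insert z W).image (flipAt d)) (flipAt_injective d) (adj_flipAt d)
    (subcubeCoverable hcol (by omega) _ _ b _ _ hD' hS1' ?_ hS1b ?_ ?_ hS1 (by omega)) ?_
    (disjoint_puncturedSubcube hd d₀ x).symm (by simp) ?_
  · rw [Finset.empty_union, Finset.image_subset_iff]
    intro u hu
    refine flipAt_mem_subcube_flipAt hd (puncturedSubcube_subset (d₀ := d₀) ?_)
    rcases Finset.mem_insert.1 hu with rfl | hu
    · exact hz
    · exact hW hu
  · rw [Finset.empty_union]
    intro w hw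
    obtain ⟨u, hu, rfl⟩ := Finset.mem_image.1 hw
    rw [hcol]
    rcases Finset.mem_insert.1 hu with rfl | hu
    · rw [hzb]
    · rw [hWb u hu]
  · rw [Finset.empty_union, hcU]
    omega
  · rwa [hii, Finset.union_insert]
  · rw [hii, Finset.disjoint_insert_right]
    exact ⟨fun h => hzS (Finset.mem_union_left _ h), hWE⟩

include hcol in
theorem puncturedCoverable_succ (hm : 3 ≤ m) (ih : PuncturedCoverable col m) :
    PuncturedCoverable col (m + 1) := by
  intro D x d₀ b S T hD hd₀ hS hT hSb hTb hc h1 hk _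
  have step : ∀ d ∈ D, d ≠ d₀ → (S.filter fun w => w d = x d).card + 2 ≤ m →
      (T.filter fun w => w d = x d).card + 2 ≤ m →
      1 ≤ (S.filter fun w => ¬ w d = x d).card →
      (4 ≤ m ∨ (S.filter fun w => w d = x d).card = 0 ∨
        ∃ v ∈ S ∪ T, v d = x d ∧ ∃ i ∈ D.erase d, i ≠ d₀ ∧ v i = x i) →
      PathCover (hypercubeGraph n) (puncturedSubcube D x d₀) S T := fun d hd hne h2 h3 h4 h5 =>
    punctured_step hcol hm ih hD hd₀ hd hne hS hT hSb hTb hc h1 (by omega) h2 h3 h4 h5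
  have hlt : ∀ (A : Finset (Fin n → Bool)) (d : Fin n), ∀ a ∈ A, a d ≠ x d →
      1 ≤ (A.filter fun w => ¬ w d = x d).card ∧
        (A.filter fun w => w d = x d).card + 1 ≤ A.card := fun A d a ha had => by
    have h2 := Finset.card_filter_add_card_filter_not (s := A) (fun w => w d = x d)
    have : 0 < (A.filter fun w => ¬ w d = x d).card :=
      Finset.card_pos.2 ⟨a, Finset.mem_filter.2 ⟨ha, had⟩⟩
    omega
  -- A single source is placed in the full half; several sources are separated.
  rcases h1.eq_or_lt with h1 | h1
  · obtain ⟨s, hs⟩ := Finset.card_eq_one.1 h1.symm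
    have hs' : s ∈ S := by simp [hs]
    obtain ⟨d, hd, hne, hsd⟩ := exists_ne_of_mem_puncturedSubcube (hS hs')
    have h2 := hlt S d s hs' hsd
    have h3 := Finset.card_filter_le T (fun w => w d = x d)
    exact step d hd hne (by omega) (by omega) h2.1 (Or.inr (Or.inl (by omega)))
  · obtain ⟨d, hd, hne, s, hs, s', hs', hsd, hsd'⟩ : ∃ d ∈ D, d ≠ d₀ ∧ ∃ s ∈ S, ∃ s' ∈ S,
        s d = x d ∧ s' d ≠ x d := by
      obtain ⟨s, hs, s', hs', hss⟩ := Finset.one_lt_card.1 h1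
      obtain ⟨d, hd, hne, hdd⟩ := exists_direction hcol (by rw [hSb s hs, hSb s' hs']) hss
        (puncturedSubcube_subset (hS hs)) (puncturedSubcube_subset (hS hs')) d₀
      refine ⟨d, hd, hne, ?_⟩
      by_cases h : s d = x d
      · exact ⟨s, hs, s', hs', h, h ▸ hdd.symm⟩
      · refine ⟨s', hs', s, hs, ?_, h⟩
        revert h hdd
        cases s d <;> cases s' d <;> cases x d <;> simp
    have h2 := hlt S d s' hs' hsd'
    have hTc := Finset.card_filter_add_card_filter_not (s := T) (fun w => w d = x d)
    by_cases hT0 : (T.filter fun w => w d = x d).card + 2 ≤ m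
    · by_cases hex : 4 ≤ m ∨ (S.filter fun w => w d = x d).card = 0 ∨
          ∃ v ∈ S ∪ T, v d = x d ∧ ∃ i ∈ D.erase d, i ≠ d₀ ∧ v i = x i
      · exact step d hd hne (by omega) hT0 h2.1 hex
      by_cases hTe : (T.filter fun w => w d = x d).card = 0
      · refine punctured_cross hcol hm ih hD hd₀ hd hne hS hT hSb hTb hc (by omega) ?_ (by omega)
        rw [hTe]
        exact Finset.card_pos.2 ⟨s, Finset.mem_filter.2 ⟨hs, hsd⟩⟩
      -- What remains is `m = 3` with two sources, where `s` and `t` are the only ends in the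
      -- punctured half and both are opposite there to the removed edge. In the other two directions
      -- `e`, `e'` they lie in the full half. If `s'` agrees with `x` in both, splitting along `e`
      -- leaves `s'` as a non-opposite end; otherwise splitting where `s'` differs from `x` leaves
      -- no source in the punctured half.
      obtain ⟨t, ht⟩ := Finset.card_pos.1 (Nat.pos_of_ne_zero hTe)
      rw [Finset.mem_filter] at ht
      push Not at hex
      obtain ⟨hm4, -, hopp⟩ := hex
      have hm3 : m = 3 := by omega
      subst hm3
      have hso := hopp s (Finset.mem_union_left _ hs) hsd
      have hto := hopp t (Finset.mem_union_right _ ht.1) ht.2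
      obtain ⟨e, e', hee, hDe⟩ := Finset.card_eq_two.1 (show ((D.erase d).erase d₀).card = 2 by
        rw [Finset.card_erase_of_mem (Finset.mem_erase.2 ⟨hne.symm, hd₀⟩),
          Finset.card_erase_of_mem hd, hD])
      have he : e ≠ d₀ ∧ e ≠ d ∧ e ∈ D := by
        have : e ∈ (D.erase d).erase d₀ := by simp [hDe]
        simpa using this
      have he' : e' ≠ d₀ ∧ e' ≠ d ∧ e' ∈ D := by
        have : e' ∈ (D.erase d).erase d₀ := by simp [hDe]
        simpa using this
      have hSS : ∀ a ∈ S, a = s ∨ a = s' := by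
        have hss' : s ≠ s' := by rintro rfl; exact hsd' hsd
        have : ({s, s'} : Finset (Fin n → Bool)) = S := by
          refine Finset.eq_of_subset_of_card_le ?_ (by rw [Finset.card_pair hss']; omega)
          intro a ha
          rw [Finset.mem_insert, Finset.mem_singleton] at ha
          rcases ha with rfl | rfl
          · exact hs
          · exact hs'
        intro a ha
        simpa [← this] using ha
      have hzero : ∀ i ∈ D, i ≠ d → i ≠ d₀ → s' i ≠ x i →
          (S.filter fun w => w i = x i).card = 0 := fun i hi hid hi0 hsi => by
        rw [Finset.card_eq_zero, Finset.filter_eq_empty_iff]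
        intro a ha
        rcases hSS a ha with rfl | rfl
        · exact hso i (Finset.mem_erase.2 ⟨hid, hi⟩) hi0
        · exact hsi
      have step' : ∀ i ∈ D, i ≠ d → i ≠ d₀ → ((S.filter fun w => w i = x i).card = 0 ∨
          ∃ v ∈ S ∪ T, v i = x i ∧ ∃ j ∈ D.erase i, j ≠ d₀ ∧ v j = x j) →
          PathCover (hypercubeGraph n) (puncturedSubcube D x d₀) S T :=
        fun i hi hid hi0 h => by
          have h3 := hlt S i s hs (hso i (Finset.mem_erase.2 ⟨hid, hi⟩) hi0)
          have h4 := hlt T i t ht.1 (hto i (Finset.mem_erase.2 ⟨hid, hi⟩) hi0)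
          exact step i hi hi0 (by omega) (by omega) h3.1 (Or.inr h)
      by_cases h3 : s' e = x e
      · by_cases h4 : s' e' = x e'
        · exact step' e he.2.2 he.2.1 he.1 (Or.inr ⟨s', Finset.mem_union_left _ hs', h3, e',
            Finset.mem_erase.2 ⟨hee.symm, he'.2.2⟩, he'.1, h4⟩)
        · exact step' e' he'.2.2 he'.2.1 he'.1 (Or.inl (hzero e' he'.2.2 he'.2.1 he'.1 h4))
      · exact step' e he.2.2 he.2.1 he.1 (Or.inl (hzero e he.2.2 he.2.1 he.1 h3))
    -- The capacity `m - 2` of the punctured half is exceeded only if all `m - 1` targets lie in it.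
    · refine punctured_cut hcol hm ih hD hd₀ hd hne hS hT hSb hTb hc (by omega)
        (Finset.card_pos.2 ⟨s, Finset.mem_filter.2 ⟨hs, hsd⟩⟩) h2.1 fun t ht => ?_
      by_contra htd
      have := (hlt T d t ht htd).2
      omega

include hcol in
theorem puncturedCoverable (hm : 3 ≤ m) : PuncturedCoverable col m := by
  induction m, hm using Nat.le_induction with
  | base => exact puncturedCoverable_three hcol
  | succ m hm ih => exact puncturedCoverable_succ hcol hm ih

end Punctured

/-! ### The theorem: the whole cube, coloured by membership in `X`. -/

theorem lemma2p4 (n k : ℕ) (hn : 4 ≤ n) (hk1 : 1 ≤ k) (hk2 : k + 2 ≤ n)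
    (x y : Fin n → Bool) (hxy : (hypercubeGraph n).Adj x y)
    (X Y : Set (Fin n → Bool)) (hXY : (hypercubeGraph n).IsBipartiteWith X Y)
    (S T : Finset (Fin n → Bool)) (hS : S.card = k) (hT : T.card = k)
    (hSX : (S : Set (Fin n → Bool)) ⊆ X \ {x, y})
    (hTY : (T : Set (Fin n → Bool)) ⊆ Y \ {x, y}) :
    HasDisjointPathCover (hypercubeGraph n) S T {x, y}ᶜ k := by
  classical
  obtain ⟨d₀, rfl⟩ := exists_eq_flipAt hxy
  have hdis : ∀ v, v ∈ X → v ∉ Y := fun _ h => Set.disjoint_left.1 hXY.disjoint h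
  have hcol : ∀ i v, decide (flipAt i v ∈ X) = !decide (v ∈ X) := fun i v => by
    rw [← decide_not, decide_eq_decide]
    rcases hXY.mem_of_adj (adj_flipAt i v) with ⟨h1, h2⟩ | ⟨h1, h2⟩
    · exact ⟨fun h => absurd h2 (hdis _ h), fun h => absurd h1 h⟩
    · exact ⟨fun _ h => hdis _ h h1, fun _ => h2⟩
  have huniv : subcube Finset.univ x = Finset.univ := by ext w; simp [mem_subcube]
  have hsub : ∀ A : Finset (Fin n → Bool), (∀ a ∈ A, a ∉ ({x, flipAt d₀ x} : Set _)) →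
      A ⊆ puncturedSubcube Finset.univ x d₀ := fun A hA a ha => by
    have := hA a ha
    rw [mem_puncturedSubcube, huniv]
    simpa using this
  have hcov := puncturedCoverable (col := fun v => decide (v ∈ X)) hcol (show 3 ≤ n by omega)
    Finset.univ x d₀ true S T (by simp)
    (by simp) (hsub S fun a ha => (hSX ha).2) (hsub T fun a ha => (hTY ha).2)
    (fun a ha => by simpa using (hSX ha).1)
    (fun a ha => by simpa using fun h => hdis a h (hTY ha).1) (by omega) (by omega) (by omega)
    (Or.inl hn)
  have h := hcov.hasDisjointPathCover
  rw [hS] at h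
  convert h using 1
  ext v
  rw [Finset.mem_coe, mem_puncturedSubcube, huniv]
  simp
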